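/- **Theorem.** Let $M$ be a smooth manifold (Hausdorff, second countable, without boundary) of dimension $n\ge 0$, and let $A=C^\infty(M)$. For $a\in A$ and $\varphi\in\operatorname{End}_{\mathbb R}(A)$ put $\delta_a(\varphi)=\varphi\circ a-a\circ\varphi$. For $k\ge 0$ let $$\mathrm{Diff}_k(M)=\{\Delta\in\operatorname{End}_{\mathbb R}(A)\;:\;\delta_{a_0}\circ\cdots\circ\delta_{a_k}(\Delta)=0\ \text{ for all }a_0,\dots,a_k\in A\},\qquad \mathrm{Diff}_{-1}(M)=0 .$$ Let $\mathrm{Smbl}(M)=\bigoplus_{k\ge0}\mathrm{Smbl}_k(M)$ with $\mathrm{Smbl}_k(M)=\mathrm{Diff}_k(M)/\mathrm{Diff}_{k-1}(M)$, equipped with the product $\mathrm{Smbl}_k\times\mathrm{Smbl}_l\to\mathrm{Smbl}_{k+l}$ induced by composition and the bracket $\mathrm{Smbl}_k\times\mathrm{Smbl}_l\to\mathrm{Smbl}_{k+l-1}$ induced by the commutator of operators (zero for $k=l=0$). Let $\mathcal P_k(T^*M)\subset C^\infty(T^*M)$ be the space of smooth functions whose restriction to every fibre $T^*_qM$ is a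 homogeneous polynomial of degree $k$, let $\mathcal P(T^*M)=\sum_{k\ge0}\mathcal P_k(T^*M)$, and let $$\{F,G\}=\sum_{i=1}^n\Big(\frac{\partial F}{\partial p_i}\frac{\partial G}{\partial q^i}-\frac{\partial F}{\partial q^i}\frac{\partial G}{\partial p_i}\Big)$$ be the canonical bracket in canonical local coordinates $(q^i,p_i)$ of $T^*M$. Then: 1. $\mathrm{Smbl}(M)$ is a Poisson algebra; the sum $\mathcal P(T^*M)=\bigoplus_k\mathcal P_k(T^*M)$ is direct; and $\mathcal P(T^*M)$ is closed under the canonical bracket and is a Poisson algebra with it. 2. For every $k\ge0$ there is a linear map, the symbol map $\sigma_k\colon\mathrm{Diff}_k(M)\to\mathcal P_k(T^*M)$, with $$\sigma_k(\Delta)(q,d_qf)=\frac1{k!}\,\big(\delta_f^{\,k}\Delta\big)(1)(q)=\frac1{k!}\,[\cdots[[\Delta,f],f],\cdots,f](1)(q)\qquad(f\in C^\infty(M),\ q\in M),$$ and the sequence $$0\longrightarrow\mathrm{Diff}_{k-1}(M)\hookrightarrow\mathrm{Diff}_k(M)\xrightarrow{\ \sigma_k\ }\mathcal P_k(T^*M)\longrightarrow0$$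 is exact. 3. The symbol maps induce an isomorphism of Poisson algebras $\mathrm{Smbl}(M)\cong\mathcal P(T^*M)$: there is an isomorphism of unital $\mathbb R$-algebras that preserves the brackets and sends the class of $\Delta\in\mathrm{Diff}_k(M)$ in $\mathrm{Smbl}_k(M)$ to $\sigma_k(\Delta)$. -/

import Mathlib

open scoped Manifold ContDiff DirectSum

noncomputable section

namespace SymbolAlgebra

/-! ### Poisson brackets on commutative algebras -/

/-- A bilinear operation `b` on a commutative `K`-algebra `A` is a Poisson bracket: it is a Lie
bracket (alternating, Jacobi identity) which is a derivation in its first argument. -/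
structure IsPoissonBracket {K A : Type*} [CommRing K] [CommRing A] [Algebra K A]
    (b : A →ₗ[K] A →ₗ[K] A) : Prop where
  self_eq_zero : ∀ x, b x x = 0
  jacobi : ∀ x y z, b x (b y z) + b y (b z x) + b z (b x y) = 0
  leibniz : ∀ x y z, b (x * y) z = x * b y z + b x z * y

/-! ### Differential operators on a commutative algebra, in the sense of Grothendieck -/

section Algebraic

variable (K : Type*) {A : Type*} [CommRing K] [CommRing A] [Algebra K A]

variable (A) in
/-- The ring `End_K(A)` of `K`-linear maps `A → A`, with composition as product. -/
def Op : Type _ := Module.End K A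

namespace Op

instance : Ring (Op K A) := inferInstanceAs (Ring (Module.End K A))

instance : Algebra K (Op K A) := inferInstanceAs (Algebra K (Module.End K A))

instance : FunLike (Op K A) A A := inferInstanceAs (FunLike (Module.End K A) A A)

variable {K}

theorem ext {φ ψ : Op K A} (h : ∀ u, φ u = ψ u) : φ = ψ := LinearMap.ext h

theorem mul_apply (φ ψ : Op K A) (u : A) : (φ * ψ) u = φ (ψ u) := rfl

theorem sub_apply (φ ψ : Op K A) (u : A) : (φ - ψ) u = φ u - ψ u := rfl

theorem zero_apply (u : A) : (0 : Op K A) u = 0 := rfl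

variable (K)

/-- Multiplication by `a`, as an operator on `A`. -/
def mulBy (a : A) : Op K A := LinearMap.mulLeft K a

theorem mulBy_apply (a u : A) : mulBy K a u = a * u := rfl

theorem mulBy_mul (a b : A) : mulBy K a * mulBy K b = mulBy K (a * b) :=
  ext fun u => (mul_assoc a b u).symm

end Op

/-- `δ_a = r_a - l_a` on `End_K A`, that is, `δ_a φ = φ ∘ (a ·) - (a ·) ∘ φ`. -/
def delta (a : A) : Module.End K (Op K A) :=
  LinearMap.mulRight K (Op.mulBy K a) -
    LinearMap.mulLeft K (Op.mulBy K a)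

variable {K} in
theorem delta_apply (a : A) (φ : Op K A) :
    delta K a φ = φ * Op.mulBy K a - Op.mulBy K a * φ := rfl

variable (A)

/-- The differential operators of order `< m` on `A`: the `φ ∈ End_K A` that are killed by every
composition `δ_{a_0} ∘ ⋯ ∘ δ_{a_{m-1}}` of `m` of the maps `δ_a`. For `m = 0` it is `{0}`. -/
def diffLT (m : ℕ) : Submodule K (Op K A) :=
  ⨅ a : Fin m → A, LinearMap.ker (List.ofFn fun i => delta K (a i)).prod

/-- `Diff_k(A)`: the differential operators of order `≤ k`, killed by every
`δ_{a_0} ∘ ⋯ ∘ δ_{a_k}`. Thus `Diff_{k-1}(A)` is `diffLT K A k`, also for `k = 0`, where it is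
zero. -/
abbrev Diff (k : ℕ) : Submodule K (Op K A) := diffLT K A (k + 1)

/-- `Smbl_k(A) = Diff_k(A) / Diff_{k-1}(A)`. -/
def Smbl (k : ℕ) : Type _ := Diff K A k ⧸ (diffLT K A k).submoduleOf (Diff K A k)

instance (k : ℕ) : AddCommGroup (Smbl K A k) :=
  inferInstanceAs (AddCommGroup (Diff K A k ⧸ (diffLT K A k).submoduleOf (Diff K A k)))

instance (k : ℕ) : Module K (Smbl K A k) :=
  inferInstanceAs (Module K (Diff K A k ⧸ (diffLT K A k).submoduleOf (Diff K A k)))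

/-- The symbol algebra `Smbl_*(A) = ⨁_k Smbl_k(A)`. -/
abbrev SmblAlg : Type _ := ⨁ k, Smbl K A k

variable {K A}

theorem mem_diffLT_zero {φ : Op K A} : φ ∈ diffLT K A 0 ↔ φ = 0 := by
  simp [diffLT]

theorem mem_diffLT_succ {m : ℕ} {φ : Op K A} :
    φ ∈ diffLT K A (m + 1) ↔ ∀ a, delta K a φ ∈ diffLT K A m := by
  simp only [diffLT, Submodule.mem_iInf, LinearMap.mem_ker]
  constructor
  · intro h a b
    have := h (Fin.snoc b a)
    rw [List.ofFn_succ', List.concat_eq_append, List.prod_append, List.prod_singleton] at this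
    simpa using this
  · intro h a
    have := h (a (Fin.last m)) (fun i => a i.castSucc)
    rw [List.ofFn_succ', List.concat_eq_append, List.prod_append, List.prod_singleton]
    exact this

theorem diffLT_le_succ (m : ℕ) : diffLT K A m ≤ diffLT K A (m + 1) := by
  induction m with
  | zero =>
    intro φ h
    rw [mem_diffLT_zero.1 h]
    exact zero_mem _
  | succ m ih =>
    intro φ h
    exact mem_diffLT_succ.2 fun a => ih (mem_diffLT_succ.1 h a)

theorem delta_mul (a : A) (φ ψ : Op K A) :
    delta K a (φ * ψ) = delta K a φ * ψ + φ * delta K a ψ := by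
  simp only [delta_apply]
  rw [sub_mul, mul_sub, mul_assoc, mul_assoc, mul_assoc]
  abel

theorem mul_mem_diffLT : ∀ (k l : ℕ) {φ ψ : Op K A},
    φ ∈ diffLT K A k → ψ ∈ diffLT K A l → φ * ψ ∈ diffLT K A (k + l - 1)
  | 0, l, φ, ψ, hφ, _ => by
    rw [mem_diffLT_zero.1 hφ, zero_mul]
    exact zero_mem _
  | k + 1, 0, φ, ψ, _, hψ => by
    rw [mem_diffLT_zero.1 hψ, mul_zero]
    exact zero_mem _
  | k + 1, l + 1, φ, ψ, hφ, hψ => by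
    have e : k + 1 + (l + 1) - 1 = k + l + 1 := by omega
    rw [e, mem_diffLT_succ]
    intro a
    rw [delta_mul]
    refine add_mem ?_ ?_
    · have := mul_mem_diffLT k (l + 1) (mem_diffLT_succ.1 hφ a) hψ
      exact this
    · have := mul_mem_diffLT (k + 1) l hφ (mem_diffLT_succ.1 hψ a)
      rwa [show k + 1 + l - 1 = k + l by omega] at this
termination_by k l => k + l

theorem mul_mem_diff {k l : ℕ} {φ ψ : Op K A} (hφ : φ ∈ Diff K A k)
    (hψ : ψ ∈ Diff K A l) : φ * ψ ∈ Diff K A (k + l) := by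
  have := mul_mem_diffLT (k + 1) (l + 1) hφ hψ
  rwa [show k + 1 + (l + 1) - 1 = k + l + 1 by omega] at this

theorem eq_mulLeft_of_mem_diff_zero {φ : Op K A} (h : φ ∈ Diff K A 0) :
    φ = Op.mulBy K (φ 1) := by
  refine Op.ext fun u => ?_
  have h1 := mem_diffLT_zero.1 (mem_diffLT_succ.1 h u)
  have h2 := congrArg (fun χ : Op K A => χ 1) h1
  simp only [delta_apply, Op.sub_apply, Op.mul_apply, Op.mulBy_apply, mul_one,
    Op.zero_apply] at h2
  rw [Op.mulBy_apply, mul_comm, ← sub_eq_zero]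
  exact h2

theorem commutator_mem_diffLT : ∀ (k l : ℕ) {φ ψ : Op K A},
    φ ∈ diffLT K A k → ψ ∈ diffLT K A l → φ * ψ - ψ * φ ∈ diffLT K A (k + l - 2)
  | 0, l, φ, ψ, hφ, _ => by
    rw [mem_diffLT_zero.1 hφ, zero_mul, mul_zero, sub_zero]
    exact zero_mem _
  | k + 1, 0, φ, ψ, _, hψ => by
    rw [mem_diffLT_zero.1 hψ, zero_mul, mul_zero, sub_zero]
    exact zero_mem _
  | 1, 1, φ, ψ, hφ, hψ => by
    rw [eq_mulLeft_of_mem_diff_zero hφ, eq_mulLeft_of_mem_diff_zero hψ,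
      Op.mulBy_mul, Op.mulBy_mul, mul_comm, sub_self]
    exact zero_mem _
  | k + 1, l + 2, φ, ψ, hφ, hψ => by
    have e : k + 1 + (l + 2) - 2 = k + l + 1 := by omega
    rw [e, mem_diffLT_succ]
    intro a
    have h1 := commutator_mem_diffLT k (l + 2) (mem_diffLT_succ.1 hφ a) hψ
    have h2 := commutator_mem_diffLT (k + 1) (l + 1) hφ (mem_diffLT_succ.1 hψ a)
    rw [show k + (l + 2) - 2 = k + l by omega] at h1
    rw [show k + 1 + (l + 1) - 2 = k + l by omega] at h2
    have := add_mem h1 h2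
    rw [map_sub, delta_mul, delta_mul]
    convert this using 1
    abel
  | k + 2, 1, φ, ψ, hφ, hψ => by
    rw [show k + 2 + 1 - 2 = k + 1 by omega, mem_diffLT_succ]
    intro a
    have h1 := commutator_mem_diffLT (k + 1) 1 (mem_diffLT_succ.1 hφ a) hψ
    rw [show k + 1 + 1 - 2 = k by omega] at h1
    have h0 : delta K a ψ = 0 := mem_diffLT_zero.1 (mem_diffLT_succ.1 hψ a)
    rw [map_sub, delta_mul, delta_mul, h0, mul_zero, zero_mul, add_zero, zero_add]
    exact h1
termination_by k l => k + l

theorem commutator_mem_diff {k l : ℕ} {φ ψ : Op K A} (hφ : φ ∈ Diff K A k)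
    (hψ : ψ ∈ Diff K A l) : φ * ψ - ψ * φ ∈ Diff K A (k + l - 1) := by
  have := commutator_mem_diffLT (k + 1) (l + 1) hφ hψ
  rw [show k + 1 + (l + 1) - 2 = k + l by omega] at this
  rcases Nat.eq_zero_or_pos (k + l) with h | h
  · rw [h] at this ⊢
    exact diffLT_le_succ 0 this
  · rwa [Diff, show k + l - 1 + 1 = k + l by omega]

/-! ### The symbol algebra as a commutative algebra with a bracket -/

/-- The class in `Smbl_k` of an operator of order `≤ k`. -/
def gr (k : ℕ) (φ : Diff K A k) : Smbl K A k := Submodule.Quotient.mk φ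

theorem gr_eq_zero {k : ℕ} {φ : Diff K A k} (h : (φ : Op K A) ∈ diffLT K A k) :
    gr k φ = 0 :=
  (Submodule.Quotient.mk_eq_zero _).2 h

/-- The product `Smbl_k × Smbl_l → Smbl_{k+l}`, induced by the composition of operators. -/
def smblMul (k l : ℕ) : Smbl K A k →ₗ[K] Smbl K A l →ₗ[K] Smbl K A (k + l) :=
  LinearMap.liftQ₂ _ _
    (LinearMap.mk₂ K (fun (φ : Diff K A k) (ψ : Diff K A l) =>
        gr (k + l) ⟨φ.1 * ψ.1, mul_mem_diff φ.2 ψ.2⟩)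
      (fun _ _ _ => congrArg (gr _) (Subtype.ext (add_mul _ _ _)))
      (fun _ _ _ => congrArg (gr _) (Subtype.ext (smul_mul_assoc _ _ _)))
      (fun _ _ _ => congrArg (gr _) (Subtype.ext (mul_add _ _ _)))
      (fun _ _ _ => congrArg (gr _) (Subtype.ext (mul_smul_comm _ _ _))))
    (fun φ hφ => LinearMap.ext fun ψ => gr_eq_zero (by
      have := mul_mem_diffLT k (l + 1) hφ ψ.2
      exact this))
    (fun ψ hψ => LinearMap.ext fun φ => gr_eq_zero (by
      have := mul_mem_diffLT (k + 1) l φ.2 hψ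
      rwa [show k + 1 + l - 1 = k + l by omega] at this))

theorem smblMul_gr {k l : ℕ} (φ : Diff K A k) (ψ : Diff K A l) :
    smblMul k l (gr k φ) (gr l ψ) =
      gr (k + l) ⟨φ.1 * ψ.1, mul_mem_diff φ.2 ψ.2⟩ := rfl

/-- The bracket `Smbl_k × Smbl_l → Smbl_{k+l-1}`, induced by the commutator of operators. (Operators
of order `0` commute, so that the bracket of `Smbl_0` with itself is zero.) -/
def smblBracketAux (k l : ℕ) : Smbl K A k →ₗ[K] Smbl K A l →ₗ[K] Smbl K A (k + l - 1) :=
  LinearMap.liftQ₂ _ _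
    (LinearMap.mk₂ K (fun (φ : Diff K A k) (ψ : Diff K A l) =>
        gr (k + l - 1) ⟨φ.1 * ψ.1 - ψ.1 * φ.1,
          commutator_mem_diff φ.2 ψ.2⟩)
      (fun _ _ _ => congrArg (gr _) (Subtype.ext (by
        simp only [Submodule.coe_add, add_mul, mul_add]; abel)))
      (fun _ _ _ => congrArg (gr _) (Subtype.ext (by
        simp only [Submodule.coe_smul, smul_mul_assoc, mul_smul_comm, smul_sub])))
      (fun _ _ _ => congrArg (gr _) (Subtype.ext (by
        simp only [Submodule.coe_add, add_mul, mul_add]; abel)))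
      (fun _ _ _ => congrArg (gr _) (Subtype.ext (by
        simp only [Submodule.coe_smul, smul_mul_assoc, mul_smul_comm, smul_sub]))))
    (fun φ hφ => LinearMap.ext fun ψ => gr_eq_zero (by
      have := commutator_mem_diffLT k (l + 1) hφ ψ.2
      rwa [show k + (l + 1) - 2 = k + l - 1 by omega] at this))
    (fun ψ hψ => LinearMap.ext fun φ => gr_eq_zero (by
      have := commutator_mem_diffLT (k + 1) l φ.2 hψ
      rwa [show k + 1 + l - 2 = k + l - 1 by omega] at this))

theorem gr_mk_congr {k l : ℕ} (h : k = l) {φ : Diff K A k} {ψ : Diff K A l}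
    (e : (φ : Op K A) = ψ) :
    (GradedMonoid.mk k (gr k φ) : GradedMonoid (Smbl K A)) = GradedMonoid.mk l (gr l ψ) := by
  subst h
  rw [Subtype.ext e]

theorem one_mem_diff_zero : (1 : Op K A) ∈ Diff K A 0 := by
  refine mem_diffLT_succ.2 fun a => mem_diffLT_zero.2 ?_
  rw [delta_apply, one_mul, mul_one, sub_self]

theorem gr_surj {k : ℕ} (x : Smbl K A k) : ∃ φ, gr k φ = x :=
  Submodule.Quotient.mk_surjective _ x

instance : GradedMonoid.GOne (Smbl K A) where
  one := gr 0 ⟨1, one_mem_diff_zero⟩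

instance : GradedMonoid.GMul (Smbl K A) where
  mul x y := smblMul _ _ x y

instance : DirectSum.GCommRing (Smbl K A) where
  mul_zero x := map_zero (smblMul _ _ x)
  zero_mul y := LinearMap.map_zero₂ (smblMul _ _) y
  mul_add x y z := map_add (smblMul _ _ x) y z
  add_mul x y z := LinearMap.map_add₂ (smblMul _ _) x y z
  one_mul := by
    rintro ⟨k, x⟩
    obtain ⟨φ, rfl⟩ := gr_surj x
    exact gr_mk_congr (zero_add k) (one_mul _)
  mul_one := by
    rintro ⟨k, x⟩
    obtain ⟨φ, rfl⟩ := gr_surj x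
    exact gr_mk_congr (add_zero k) (mul_one _)
  mul_assoc := by
    rintro ⟨k, x⟩ ⟨l, y⟩ ⟨m, z⟩
    obtain ⟨φ, rfl⟩ := gr_surj x
    obtain ⟨ψ, rfl⟩ := gr_surj y
    obtain ⟨χ, rfl⟩ := gr_surj z
    exact gr_mk_congr (add_assoc k l m) (mul_assoc _ _ _)
  mul_comm := by
    rintro ⟨k, x⟩ ⟨l, y⟩
    obtain ⟨φ, rfl⟩ := gr_surj x
    obtain ⟨ψ, rfl⟩ := gr_surj y
    have h : gr (k + l) ⟨φ.1 * ψ.1, mul_mem_diff φ.2 ψ.2⟩ =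
        gr (k + l) ⟨ψ.1 * φ.1, add_comm l k ▸ mul_mem_diff ψ.2 φ.2⟩ := by
      refine (Submodule.Quotient.eq _).2 ?_
      have := commutator_mem_diffLT (k + 1) (l + 1) φ.2 ψ.2
      rwa [show k + 1 + (l + 1) - 2 = k + l by omega] at this
    refine Eq.trans (congrArg (GradedMonoid.mk (k + l)) h) ?_
    exact gr_mk_congr (add_comm k l) rfl
  natCast n := n • gr 0 ⟨1, one_mem_diff_zero⟩
  natCast_zero := zero_smul _ _
  natCast_succ n := succ_nsmul _ n
  intCast n := n • gr 0 ⟨1, one_mem_diff_zero⟩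
  intCast_ofNat n := natCast_zsmul _ n
  intCast_negSucc_ofNat n := negSucc_zsmul _ n

instance : DirectSum.GAlgebra K (Smbl K A) where
  toFun :=
    { toFun := fun r => gr 0 (r • ⟨1, one_mem_diff_zero⟩)
      map_zero' := congrArg (gr 0) (zero_smul K _)
      map_add' := fun r s => congrArg (gr 0) (add_smul r s _) }
  map_one := congrArg (gr 0) (one_smul K _)
  map_mul r s := gr_mk_congr (K := K) (A := A) (zero_add 0).symm (by simp [mul_smul, smul_comm r s])
  commutes := by
    rintro r ⟨k, x⟩
    obtain ⟨φ, rfl⟩ := gr_surj x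
    exact gr_mk_congr (K := K) (A := A) ((zero_add k).trans (add_zero k).symm) (by simp)
  smul_def := by
    rintro r ⟨k, x⟩
    obtain ⟨φ, rfl⟩ := gr_surj x
    exact gr_mk_congr (K := K) (A := A) (φ := r • φ) (zero_add k).symm (by simp)

variable (K A)

/-- The bracket of the symbol algebra: the bilinear extension of `smblBracketAux`. -/
def smblBracket : SmblAlg K A →ₗ[K] SmblAlg K A →ₗ[K] SmblAlg K A :=
  DirectSum.toModule K ℕ _ fun k => LinearMap.flip <| DirectSum.toModule K ℕ _ fun l =>
    LinearMap.flip <| (smblBracketAux k l).compr₂ (DirectSum.lof K ℕ (Smbl K A) (k + l - 1))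

variable {K A}

theorem of_mul_of {k l : ℕ} (φ : Diff K A k) (ψ : Diff K A l) :
    DirectSum.of (Smbl K A) k (gr k φ) * DirectSum.of (Smbl K A) l (gr l ψ) =
      DirectSum.of (Smbl K A) (k + l)
        (gr (k + l) ⟨φ.1 * ψ.1, mul_mem_diff φ.2 ψ.2⟩) :=
  DirectSum.of_mul_of _ _

theorem smblBracket_of {k l : ℕ} (φ : Diff K A k) (ψ : Diff K A l) :
    smblBracket K A (DirectSum.of (Smbl K A) k (gr k φ)) (DirectSum.of (Smbl K A) l (gr l ψ)) =
      DirectSum.of (Smbl K A) (k + l - 1)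
        (gr (k + l - 1) ⟨φ.1 * ψ.1 - ψ.1 * φ.1,
          commutator_mem_diff φ.2 ψ.2⟩) := by
  rw [← DirectSum.lof_eq_of K, ← DirectSum.lof_eq_of K, ← DirectSum.lof_eq_of K, smblBracket,
    DirectSum.toModule_lof, LinearMap.flip_apply, DirectSum.toModule_lof, LinearMap.flip_apply,
    LinearMap.compr₂_apply]
  rfl

end Algebraic

/-! ### Functions on the cotangent bundle -/

section Cotangent

variable (n : ℕ) (M : Type*) [TopologicalSpace M] [ChartedSpace (EuclideanSpace ℝ (Fin n)) M]
  [IsManifold (𝓡 n) ∞ M]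

/-- The algebra `C^∞(M)`. -/
abbrev SmoothFun : Type _ := C^∞⟮𝓡 n, M; 𝓘(ℝ, ℝ), ℝ⟯

/-- The cotangent bundle `T*M`, with Mathlib's structure of a smooth vector bundle (the bundle of
linear maps from the tangent bundle to the trivial line bundle). -/
abbrev CotangentBundle : Type _ :=
  Bundle.TotalSpace (EuclideanSpace ℝ (Fin n) →L[ℝ] ℝ)
    (fun q : M => TangentSpace (𝓡 n) q →L[ℝ] ℝ)

/-- The model with corners of `T*M`; the model space is `ℝⁿ × (ℝⁿ)*`. -/
abbrev cotangentModel := (𝓡 n).prod 𝓘(ℝ, EuclideanSpace ℝ (Fin n) →L[ℝ] ℝ)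

/-- The algebra `C^∞(T*M)`. -/
abbrev CotangentFun : Type _ := C^∞⟮cotangentModel n, CotangentBundle n M; 𝓘(ℝ, ℝ), ℝ⟯

variable {n M}

/-- The covector `d_q f ∈ T*_q M`, as a point of `T*M`. -/
def differential (f : SmoothFun n M) (q : M) : CotangentBundle n M :=
  ⟨q, (mfderiv (𝓡 n) 𝓘(ℝ, ℝ) f q : TangentSpace (𝓡 n) q →L[ℝ] ℝ)⟩

/-- `∂F/∂qⁱ` at `x`, in the canonical coordinates `(q, p)` of `T*M` around `x`. These are the chart
of `T*M` at `x`, which sends a covector `p` at `q` to the pair of the coordinates of `q` in the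
chart of `M` at the base point of `x` and of the linear form on `ℝⁿ` that represents `p` in it. -/
def partialQ (i : Fin n) (F : CotangentBundle n M → ℝ) (x : CotangentBundle n M) : ℝ :=
  fderiv ℝ (F ∘ (extChartAt (cotangentModel n) x).symm) (extChartAt (cotangentModel n) x x)
    (EuclideanSpace.single i 1, 0)

/-- `∂F/∂p_i` at `x`, in the same coordinates. -/
def partialP (i : Fin n) (F : CotangentBundle n M → ℝ) (x : CotangentBundle n M) : ℝ :=
  fderiv ℝ (F ∘ (extChartAt (cotangentModel n) x).symm) (extChartAt (cotangentModel n) x x)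
    (0, EuclideanSpace.proj i)

/-- The canonical Poisson bracket
`{F, G} = ∑ i, (∂F/∂p_i ∂G/∂qⁱ - ∂F/∂qⁱ ∂G/∂p_i)` on `T*M`. -/
def canonicalBracket (F G : CotangentBundle n M → ℝ) (x : CotangentBundle n M) : ℝ :=
  ∑ i, (partialP i F x * partialQ i G x - partialQ i F x * partialP i G x)

variable (n M)

/-- `P_k(T*M)`: the smooth functions on `T*M` whose restriction to each fibre `T*_q M` is a
homogeneous polynomial of degree `k`, i.e. the diagonal restriction of a `k`-linear form. -/
def fibrePoly (k : ℕ) : Submodule ℝ (CotangentFun n M) where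
  carrier := {F | ∀ q : M,
    ∃ B : MultilinearMap ℝ (fun _ : Fin k => TangentSpace (𝓡 n) q →L[ℝ] ℝ) ℝ,
      ∀ p : TangentSpace (𝓡 n) q →L[ℝ] ℝ, F ⟨q, p⟩ = B fun _ => p}
  add_mem' := by
    intro F G hF hG q
    obtain ⟨B, hB⟩ := hF q
    obtain ⟨C, hC⟩ := hG q
    exact ⟨B + C, fun p => by
      exact congrArg₂ (· + ·) (hB p) (hC p)⟩
  zero_mem' := fun q => ⟨0, fun p => rfl⟩
  smul_mem' := by
    intro c F hF q
    obtain ⟨B, hB⟩ := hF q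
    exact ⟨c • B, fun p => by
      exact congrArg (c • ·) (hB p)⟩

variable {n M}

theorem one_mem_fibrePoly : (1 : CotangentFun n M) ∈ fibrePoly n M 0 := fun _ =>
  ⟨MultilinearMap.constOfIsEmpty ℝ _ 1, fun _ => rfl⟩

theorem mul_mem_fibrePoly {k l : ℕ} {F G : CotangentFun n M} (hF : F ∈ fibrePoly n M k)
    (hG : G ∈ fibrePoly n M l) : F * G ∈ fibrePoly n M (k + l) := by
  intro q
  obtain ⟨B, hB⟩ := hF q
  obtain ⟨C, hC⟩ := hG q
  refine ⟨((LinearMap.mul' ℝ ℝ).compMultilinearMap (B.domCoprod C)).domDomCongr finSumFinEquiv,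
    fun p => ?_⟩
  simp only [MultilinearMap.domDomCongr_apply, LinearMap.compMultilinearMap_apply,
    MultilinearMap.domCoprod_apply, LinearMap.mul'_apply]
  rw [← hB, ← hC]
  rfl

variable (n M)

/-- `P(T*M) = ⨁_k P_k(T*M) ⊆ C^∞(T*M)`, the algebra of fibrewise polynomial functions. -/
def fibrePolyAlg : Subalgebra ℝ (CotangentFun n M) :=
  (⨆ k, fibrePoly n M k).toSubalgebra
    (Submodule.mem_iSup_of_mem 0 one_mem_fibrePoly)
    (fun F G hF hG => by
      refine Submodule.iSup_induction _ (motive := fun F => F * G ∈ ⨆ k, fibrePoly n M k) hF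
        (fun k F hF => ?_) (by rw [zero_mul]; exact zero_mem _)
        (fun F F' h h' => by rw [add_mul]; exact add_mem h h')
      refine Submodule.iSup_induction _ (motive := fun G => F * G ∈ ⨆ k, fibrePoly n M k) hG
        (fun l G hG => ?_) (by rw [mul_zero]; exact zero_mem _)
        (fun G G' h h' => by rw [mul_add]; exact add_mem h h')
      exact Submodule.mem_iSup_of_mem (k + l) (mul_mem_fibrePoly hF hG))

variable {n M}

/-- `F` is the symbol of order `k` of the operator `Δ`: at `d_q f` its value is
`(1 / k!) [[⋯[[Δ, f], f]⋯], f](1)(q)`, with `k` commutators `[Δ, f] = δ_f Δ`. In local coordinates,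
if `Δ = ∑_{|α| ≤ k} a_α ∂^α`, this is `∑_{|α| = k} a_α(q) p^α` at `p = d_q f`. -/
def IsSymbol (k : ℕ) (Δ : Op ℝ (SmoothFun n M)) (F : CotangentFun n M) : Prop :=
  ∀ (f : SmoothFun n M) (q : M),
    F (differential f q) = ((k.factorial : ℝ)⁻¹ • ((delta ℝ f ^ k) Δ) 1 : SmoothFun n M) q

end Cotangent

end SymbolAlgebra

end

open SymbolAlgebra

/-!
The symbol of order `k` of an operator `Δ` along a function `f` is `(1 / k!) (δ_f^k Δ)(1)`. All the
properties of the symbol maps come from the facts that the `δ_a` are commuting derivations of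
`End A`, that `a ↦ δ_a` is linear, and that an operator of order `0` is the multiplication by its
value at `1`.

* The value at `q` depends only on `d_q f` (`symb_congr`): `δ_f^k - δ_g^k` is `δ_{f-g}` times a
  polynomial of degree `k - 1` in `δ_f` and `δ_g`, which maps `Δ` to an operator `D` of order
  `≤ 1`; then `a ↦ [D, a](1)` is a derivation and, by Hadamard's lemma, kills at `q` the functions
  with zero differential at `q`. As every covector is the differential of a function that is
  linear in a chart, this defines a function on `T*M`, which in canonical coordinates is
  polynomial in the momenta with smooth coefficients.
* The kernel of `σ_k` is `Diff_{k-1}(M)` (`symbolMap_eq_zero_iff`): if the symbol is zero, then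
  `δ_f^k Δ = 0` for all `f`, and by polarization all `k`-fold products of maps `δ_a` kill `Δ`.
* `σ_k` is surjective (`symbolMap_surjective`): by Euler's identity a function `F` that is
  homogeneous of degree `k` in the momenta is `(1 / k) ∑ i, p_i ∂F/∂p_i`; so, by induction on `k`,
  it is locally the symbol of a combination of operators `∂_i ∘ Δ_i`, where `Δ_i` has the symbol
  `∂F/∂p_i`. Local operators are glued by a partition of unity.
* Symbols of products are products of symbols, by the Leibniz rule for `δ_f` (`symb_mul`), and
  symbols of commutators are canonical brackets of symbols (`symbFun_commutator`). For the latter,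
  the Leibniz rule one degree below the top gives, with `F` and `G` the symbols of `φ` and `ψ`,
  the formula `δ_{G(df)} (δ_f^{k-1} φ / (k-1)!) (1) - δ_{F(df)} (δ_f^{l-1} ψ / (l-1)!) (1)`, where
  `a ↦ δ_a (δ_f^{k-1} φ / (k-1)!) (1)` is the fibre derivative of `F` at `df` in the direction of
  `da`. If `f` is linear in the chart, the section `df` is constant in canonical coordinates, and
  the differential of `G(df)` consists of the derivatives of `G` in the directions of the base.

Hence the symbol maps induce an isomorphism of algebras that takes the commutator bracket to the
canonical bracket. That the symbol algebra is a Poisson algebra follows from identities between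
commutators, and `P(T*M)` inherits this through the isomorphism; in particular the Jacobi identity
for the canonical bracket requires no computation in coordinates.
-/

namespace SymbolAlgebra

/-! ### Iterated commutators and symbols on a commutative algebra -/

section Algebra

variable {K A : Type*} [Field K] [CommRing A] [Algebra K A]

/-- A polynomial with coefficients in a vector space that vanishes at every scalar has zero
coefficients. -/
theorem eq_zero_of_sum_pow_smul_eq_zero [CharZero K] {V : Type*} [AddCommGroup V] [Module K V]
    {N : ℕ} {v : ℕ → V} (h : ∀ t : K, ∑ j ∈ Finset.range N, t ^ j • v j = 0) {j : ℕ} (hj : j < N) :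
    v j = 0 := by
  refine (Module.forall_dual_apply_eq_zero_iff K _).1 fun ℓ => ?_
  have hp : (∑ j ∈ Finset.range N, Polynomial.C (ℓ (v j)) * Polynomial.X ^ j) = 0 := by
    refine Polynomial.funext fun t => ?_
    have := congrArg ℓ (h t)
    rw [map_sum, map_zero] at this
    rw [Polynomial.eval_finsetSum, Polynomial.eval_zero, ← this]
    refine Finset.sum_congr rfl fun j _ => ?_
    rw [Polynomial.eval_C_mul, Polynomial.eval_pow, Polynomial.eval_X, map_smul, smul_eq_mul,
      mul_comm]
  have := congrArg (fun p => Polynomial.coeff p j) hp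
  simpa [Polynomial.finsetSum_coeff, Polynomial.coeff_C_mul, Polynomial.coeff_X_pow, hj] using this

theorem delta_commute (a b : A) : Commute (delta K a) (delta K b) := by
  refine LinearMap.ext fun φ => ?_
  have h : Op.mulBy K a * Op.mulBy K b = Op.mulBy K b * Op.mulBy K a := by
    rw [Op.mulBy_mul, Op.mulBy_mul, mul_comm]
  simp only [Module.End.mul_apply, delta_apply, sub_mul, mul_sub, mul_assoc]
  rw [h, ← mul_assoc (Op.mulBy K a) (Op.mulBy K b), h, mul_assoc]
  abel

theorem delta_add (a b : A) : delta K (a + b) = delta K a + delta K b := by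
  refine LinearMap.ext fun φ => ?_
  have h : Op.mulBy K (a + b) = Op.mulBy K a + Op.mulBy K b := Op.ext fun u => add_mul a b u
  simp only [LinearMap.add_apply, delta_apply, h, mul_add, add_mul]
  abel

theorem delta_smul (c : K) (a : A) : delta K (c • a) = c • delta K a := by
  refine LinearMap.ext fun φ => ?_
  have h : Op.mulBy K (c • a) = c • Op.mulBy K a := Op.ext fun u => smul_mul_assoc c a u
  simp only [LinearMap.smul_apply, delta_apply, h, smul_sub, smul_mul_assoc, mul_smul_comm]

variable (K) in
/-- The linear map `a ↦ δ_a`. -/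
def deltaHom : A →ₗ[K] Module.End K (Op K A) where
  toFun := delta K
  map_add' := delta_add
  map_smul' := delta_smul

theorem delta_mulBy (a b : A) : delta K a (Op.mulBy K b) = 0 := by
  rw [delta_apply, Op.mulBy_mul, Op.mulBy_mul, mul_comm, sub_self]

theorem delta_mul_left (a b : A) (φ : Op K A) :
    delta K (a * b) φ = delta K a φ * Op.mulBy K b + Op.mulBy K a * delta K b φ := by
  simp only [delta_apply, ← Op.mulBy_mul, sub_mul, mul_sub, mul_assoc]
  abel

theorem diffLT_mono {m m' : ℕ} (h : m ≤ m') : diffLT K A m ≤ diffLT K A m' :=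
  monotone_nat_of_le_succ (f := diffLT K A) diffLT_le_succ h

theorem delta_pow_mem {m : ℕ} (f : A) : ∀ (j : ℕ) {φ : Op K A}, φ ∈ diffLT K A (m + j) →
    (delta K f ^ j) φ ∈ diffLT K A m
  | 0, _, h => h
  | j + 1, φ, h => by
    rw [pow_succ, Module.End.mul_apply]
    exact delta_pow_mem f j (mem_diffLT_succ.1 h f)

theorem mulBy_mem_diff_zero (a : A) : Op.mulBy K a ∈ Diff K A 0 :=
  mem_diffLT_succ.2 fun b => mem_diffLT_zero.2 (delta_mulBy b a)

/-- Polarization: since the `δ_a` commute, the condition of order `< k` need only be tested on the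
powers `δ_f^k`. The coefficient of `t` in `δ_{ta+f}^{k+1} φ = 0` is `(k+1) δ_f^k (δ_a φ)`, which
gives the induction step. -/
theorem mem_diffLT_of_delta_pow_eq_zero [CharZero K] : ∀ (k : ℕ) {φ : Op K A},
    (∀ f : A, (delta K f ^ k) φ = 0) → φ ∈ diffLT K A k
  | 0, _, h => mem_diffLT_zero.2 (h 0)
  | k + 1, φ, h => by
    refine mem_diffLT_succ.2 fun a => mem_diffLT_of_delta_pow_eq_zero k fun f => ?_
    have key : ∀ t : K, ∑ j ∈ Finset.range (k + 2), t ^ j •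
        (((k + 1).choose j : K) • (delta K f ^ (k + 1 - j) * delta K a ^ j) φ) = 0 := by
      intro t
      have hc : Commute (t • delta K a) (delta K f) := (delta_commute a f).smul_left t
      have := h (t • a + f)
      rw [delta_add, delta_smul, hc.add_pow, LinearMap.sum_apply] at this
      rw [← this]
      refine Finset.sum_congr rfl fun j _ => ?_
      rw [smul_pow, ((delta_commute f a).pow_pow _ _).eq, smul_mul_assoc, smul_mul_assoc,
        LinearMap.smul_apply, ← Nat.cast_comm, ← nsmul_eq_mul, LinearMap.smul_apply,
        Nat.cast_smul_eq_nsmul]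
    have := eq_zero_of_sum_pow_smul_eq_zero key (j := 1) (by omega)
    rw [smul_eq_zero_iff_right (by simp; exact_mod_cast k.succ_ne_zero)] at this
    simpa using this

/-- The divided power `(1 / k!) δ_f^k φ` of the action of `f` on operators. -/
def dpow (k : ℕ) (f : A) (φ : Op K A) : Op K A := (k.factorial : K)⁻¹ • (delta K f ^ k) φ

theorem dpow_zero (f : A) (φ : Op K A) : dpow 0 f φ = φ := by simp [dpow]

theorem dpow_mem {m j : ℕ} (f : A) {φ : Op K A} (h : φ ∈ diffLT K A (m + j)) :
    dpow j f φ ∈ diffLT K A m :=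
  Submodule.smul_mem _ _ (delta_pow_mem f j h)

theorem dpow_eq_zero {m j : ℕ} (f : A) {φ : Op K A} (h : φ ∈ diffLT K A m) (hj : m ≤ j) :
    dpow j f φ = 0 :=
  mem_diffLT_zero.1 (dpow_mem f (diffLT_mono (by omega) h))

/-- The Leibniz rule for the derivation `δ_f` of `End_K A`, in divided powers. -/
theorem dpow_mul [CharZero K] (N : ℕ) (f : A) (φ ψ : Op K A) :
    dpow N f (φ * ψ) =
      ∑ ij ∈ Finset.HasAntidiagonal.antidiagonal N, dpow ij.1 f φ * dpow ij.2 f ψ := by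
  have h : (delta K f ^ N) (φ * ψ) = ∑ ij ∈ Finset.HasAntidiagonal.antidiagonal N,
      N.choose ij.1 • ((delta K f ^ ij.1) φ * (delta K f ^ ij.2) ψ) := by
    induction N with
    | zero => simp
    | succ N ih =>
      rw [pow_succ', Module.End.mul_apply, ih, map_sum,
        Finset.sum_antidiagonal_choose_succ_nsmul
          (fun i j => (delta K f ^ i) φ * (delta K f ^ j) ψ), ← Finset.sum_add_distrib]
      refine Finset.sum_congr rfl fun ij hij => ?_
      rw [map_nsmul, delta_mul, smul_add, pow_succ', pow_succ', Module.End.mul_apply,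
        Module.End.mul_apply, add_comm, ← Finset.HasAntidiagonal.mem_antidiagonal.1 hij,
        Nat.choose_symm_add]
  rw [dpow, h, Finset.smul_sum]
  refine Finset.sum_congr rfl fun ij hij => ?_
  rw [dpow, dpow, smul_mul_smul_comm, ← Nat.cast_smul_eq_nsmul K, smul_smul]
  congr 1
  rw [← Finset.HasAntidiagonal.mem_antidiagonal.1 hij, Nat.cast_add_choose K]
  have := Nat.cast_ne_zero (R := K).2 (ij.1 + ij.2).factorial_ne_zero
  field_simp

/-- Since `δ_a` and `δ_f` commute, the divided powers satisfy the binomial formula without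
binomial coefficients. -/
theorem dpow_add_smul [CharZero K] (k : ℕ) (f a : A) (t : K) (φ : Op K A) :
    dpow k (t • a + f) φ =
      ∑ j ∈ Finset.range (k + 1), t ^ j • dpow j a (dpow (k - j) f φ) := by
  have hc : Commute (t • delta K a) (delta K f) := (delta_commute a f).smul_left t
  rw [dpow, delta_add, delta_smul, hc.add_pow, LinearMap.sum_apply, Finset.smul_sum]
  refine Finset.sum_congr rfl fun j hj => ?_
  have hj : j ≤ k := by simpa [Nat.lt_succ_iff] using hj
  rw [smul_pow, smul_mul_assoc, smul_mul_assoc, LinearMap.smul_apply, ← Nat.cast_comm,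
    ← nsmul_eq_mul, LinearMap.smul_apply, smul_comm]
  congr 1
  rw [dpow, dpow, map_smul, smul_smul, ← Nat.cast_smul_eq_nsmul K, smul_smul,
    Module.End.mul_apply, Nat.cast_choose K hj]
  congr 1
  have := Nat.cast_ne_zero (R := K).2 k.factorial_ne_zero
  field_simp

/-- The symbol of order `k` of the operator `φ`, evaluated along `f`: the element
`(1 / k!) (δ_f^k φ)(1)` of `A`. -/
def symb (k : ℕ) (f : A) (φ : Op K A) : A := dpow k f φ 1

theorem dpow_eq_mulBy {k : ℕ} (f : A) {φ : Op K A} (h : φ ∈ Diff K A k) :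
    dpow k f φ = Op.mulBy K (symb k f φ) :=
  eq_mulLeft_of_mem_diff_zero (dpow_mem (m := 1) f (by rwa [add_comm]))

/-- In the Leibniz rule for `δ_f^{k+l}(φψ)` all terms but the one of bidegree `(k, l)` vanish for
reasons of order. -/
theorem symb_mul [CharZero K] {k l : ℕ} (f : A) {φ ψ : Op K A} (hφ : φ ∈ Diff K A k)
    (hψ : ψ ∈ Diff K A l) :
    symb (k + l) f (φ * ψ) = symb k f φ * symb l f ψ := by
  rw [symb, dpow_mul, Finset.sum_eq_single (k, l)]
  · rw [dpow_eq_mulBy f hφ, Op.mul_apply, Op.mulBy_apply]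
    rfl
  · rintro ⟨i, j⟩ hij hne
    rw [Finset.HasAntidiagonal.mem_antidiagonal] at hij
    simp only at hij ⊢
    rcases lt_trichotomy i k with hi | hi | hi
    · rw [dpow_eq_zero f hψ (by omega), mul_zero]
    · exact absurd (by rw [Prod.mk.injEq]; omega) hne
    · rw [dpow_eq_zero f hφ (by omega), zero_mul]
  · intro h
    exact absurd (Finset.HasAntidiagonal.mem_antidiagonal.2 (by rfl)) h

theorem symb_eq_zero {k : ℕ} (f : A) {φ : Op K A} (hφ : φ ∈ diffLT K A k) : symb k f φ = 0 := by
  rw [symb, dpow_eq_zero f hφ le_rfl, Op.zero_apply]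

/-- For `φ` of order `≤ k` the operator `δ_f^k φ` has order `0`, so that it is determined by its
value at `1`, which is the symbol up to the factor `k!`. -/
theorem mem_diffLT_of_symb_eq_zero [CharZero K] {k : ℕ} {φ : Op K A} (hφ : φ ∈ Diff K A k)
    (h : ∀ f, symb k f φ = 0) : φ ∈ diffLT K A k := by
  refine mem_diffLT_of_delta_pow_eq_zero k fun f => ?_
  have := dpow_eq_mulBy f hφ
  rw [h f, dpow, inv_smul_eq_iff₀ (Nat.cast_ne_zero.2 k.factorial_ne_zero)] at this
  rw [this]
  refine Op.ext fun u => ?_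
  change (k.factorial : K) • (0 * u) = 0
  rw [zero_mul, smul_zero]

theorem symb_add (k : ℕ) (f : A) (φ ψ : Op K A) :
    symb k f (φ + ψ) = symb k f φ + symb k f ψ := by
  rw [symb, dpow, map_add, smul_add]
  rfl

theorem symb_smul (k : ℕ) (f : A) (c : K) (φ : Op K A) :
    symb k f (c • φ) = c • symb k f φ := by
  rw [symb, dpow, map_smul, smul_comm]
  rfl

theorem symb_zero_mulBy (f a : A) : symb 0 f (Op.mulBy K a) = a := by
  rw [symb, dpow_zero, Op.mulBy_apply, mul_one]

/-- The divided power `(1 / (k-1)!) δ_f^{k-1} φ`, with the value `0` for `k = 0` (where the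
truncated difference `k - 1` would give the wrong term). It maps operators of order `≤ k` to
operators of order `≤ 1`. -/
def dpowPred : ℕ → A → Op K A → Op K A
  | 0, _, _ => 0
  | k + 1, f, φ => dpow k f φ

/-- One step below the top degree two terms of the Leibniz rule survive, those of bidegree
`(k, l-1)` and `(k-1, l)`. -/
theorem dpow_mul_pred [CharZero K] {k l : ℕ} (hkl : 0 < k + l) (f : A) {φ ψ : Op K A}
    (hφ : φ ∈ Diff K A k) (hψ : ψ ∈ Diff K A l) :
    dpow (k + l - 1) f (φ * ψ) =
      dpow k f φ * dpowPred l f ψ + dpowPred k f φ * dpow l f ψ := by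
  have hvan : ∀ ij ∈ Finset.HasAntidiagonal.antidiagonal (k + l - 1),
      ij ≠ (k, l - 1) ∧ ij ≠ (k - 1, l) →
      dpow ij.1 f φ * dpow ij.2 f ψ = 0 := by
    rintro ⟨i, j⟩ hij ⟨h1, h2⟩
    rw [Finset.HasAntidiagonal.mem_antidiagonal] at hij
    rw [ne_eq, Prod.mk.injEq] at h1 h2
    simp only at hij ⊢
    rcases lt_or_ge k i with hi | hi
    · rw [dpow_eq_zero f hφ (by omega), zero_mul]
    · rw [dpow_eq_zero f hψ (by omega), mul_zero]
  rw [dpow_mul]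
  rcases k with - | k
  · obtain ⟨l, rfl⟩ : ∃ l', l = l' + 1 := ⟨l - 1, by omega⟩
    rw [Finset.sum_eq_single (0, l)]
    · simp [dpowPred]
    · rintro ⟨i, j⟩ hij hne
      refine hvan _ hij ⟨hne, ?_⟩
      rw [Finset.HasAntidiagonal.mem_antidiagonal] at hij
      rw [ne_eq, Prod.mk.injEq]
      simp only at hij
      omega
    · intro h
      exact absurd (Finset.HasAntidiagonal.mem_antidiagonal.2 (by omega)) h
  · rcases l with - | l
    · rw [Finset.sum_eq_single (k, 0)]
      · simp [dpowPred]
      · rintro ⟨i, j⟩ hij hne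
        refine hvan _ hij ⟨?_, hne⟩
        rw [Finset.HasAntidiagonal.mem_antidiagonal] at hij
        rw [ne_eq, Prod.mk.injEq]
        simp only at hij
        omega
      · intro h
        exact absurd (Finset.HasAntidiagonal.mem_antidiagonal.2 (by omega)) h
    · rw [Finset.sum_eq_add (k + 1, l) (k, l + 1)]
      · rfl
      · simp
      · exact fun c hc hne => hvan c hc hne
      · intro h
        exact absurd (Finset.HasAntidiagonal.mem_antidiagonal.2 (by simp only; omega)) h
      · intro h
        exact absurd (Finset.HasAntidiagonal.mem_antidiagonal.2 (by simp only; omega)) h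

/-- The symbol of a commutator: in `δ_f^{k+l-1}[φ, ψ]` the operators `δ_f^k φ` and `δ_f^l ψ` are
multiplications by the symbols of `φ` and `ψ`, and what is left are their commutators with operators
of order `≤ 1`. This is the algebraic form of the canonical bracket: on a manifold, the latter
differentiate functions as the fibre derivatives of the symbols do. -/
theorem symb_commutator [CharZero K] {k l : ℕ} (f : A) {φ ψ : Op K A} (hφ : φ ∈ Diff K A k)
    (hψ : ψ ∈ Diff K A l) :
    symb (k + l - 1) f (φ * ψ - ψ * φ) =
      delta K (symb l f ψ) (dpowPred k f φ) 1 - delta K (symb k f φ) (dpowPred l f ψ) 1 := by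
  rcases Nat.eq_zero_or_pos (k + l) with h | h
  · obtain ⟨rfl, rfl⟩ : k = 0 ∧ l = 0 := by omega
    have := mem_diffLT_zero.1 (commutator_mem_diffLT 1 1 hφ hψ)
    rw [this]
    simp [dpowPred, symb, dpow, Op.zero_apply]
  · have h' := dpow_mul_pred (by omega) f hψ hφ
    rw [add_comm l k] at h'
    rw [symb, dpow, map_sub, smul_sub]
    change (dpow (k + l - 1) f (φ * ψ) - dpow (k + l - 1) f (ψ * φ)) 1 = _
    rw [dpow_mul_pred h f hφ hψ, h', dpow_eq_mulBy f hφ, dpow_eq_mulBy f hψ,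
      ← Op.sub_apply, delta_apply, delta_apply]
    congr 1
    abel

end Algebra


/-! ### Hadamard's lemma -/

section Hadamard

-- `E` and `F` share a universe, since smoothness of the integral is proved by an induction that
-- replaces `F` by `E →L[ℝ] F`.
universe u

variable {E F : Type u} [NormedAddCommGroup E] [NormedSpace ℝ E] [FiniteDimensional ℝ E]
  [NormedAddCommGroup F] [NormedSpace ℝ F]

theorem hasFDerivAt_intervalIntegral [CompleteSpace F] {f : E × ℝ → F} (hf : ContDiff ℝ 1 f)
    (x : E) :
    HasFDerivAt (fun x => ∫ t in (0 : ℝ)..1, f (x, t))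
      (∫ t in (0 : ℝ)..1, (fderiv ℝ f (x, t)).comp (ContinuousLinearMap.inl ℝ E ℝ)) x := by
  have hf' : Continuous fun p : E × ℝ =>
      (fderiv ℝ f p).comp (ContinuousLinearMap.inl ℝ E ℝ) :=
    (hf.continuous_fderiv one_ne_zero).clm_comp continuous_const
  have : ProperSpace E := FiniteDimensional.proper ℝ E
  obtain ⟨C, hC⟩ := ((isCompact_closedBall x 1).prod
    (isCompact_Icc (a := (0 : ℝ)) (b := 1))).exists_bound_of_continuousOn hf'.continuousOn
  refine intervalIntegral.hasFDerivAt_integral_of_dominated_of_fderiv_le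
    (F := fun x t => f (x, t))
    (F' := fun x t => (fderiv ℝ f (x, t)).comp (ContinuousLinearMap.inl ℝ E ℝ))
    (bound := fun _ => C) (Metric.closedBall_mem_nhds x one_pos) ?_ ?_ ?_ ?_ ?_ ?_
  · exact Filter.Eventually.of_forall fun y =>
      (hf.continuous.comp (by fun_prop)).aestronglyMeasurable
  · exact (hf.continuous.comp (by fun_prop)).intervalIntegrable _ _
  · exact (hf'.comp (by fun_prop)).aestronglyMeasurable
  · refine Filter.Eventually.of_forall fun t ht y hy => hC (y, t) ⟨hy, ?_⟩
    rw [Set.uIoc_of_le zero_le_one] at ht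
    exact ⟨ht.1.le, ht.2⟩
  · exact intervalIntegrable_const
  · refine Filter.Eventually.of_forall fun t _ y _ => ?_
    exact (hf.differentiable one_ne_zero (y, t)).hasFDerivAt.comp y (hasFDerivAt_prodMk_left y t)

theorem contDiff_intervalIntegral [CompleteSpace F] {f : E × ℝ → F} (hf : ContDiff ℝ ∞ f) :
    ContDiff ℝ ∞ fun x => ∫ t in (0 : ℝ)..1, f (x, t) := by
  refine contDiff_infty.2 fun m => ?_
  induction m generalizing F with
  | zero =>
    refine contDiff_zero.2 (continuous_iff_continuousAt.2 fun x => ?_)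
    exact (hasFDerivAt_intervalIntegral (hf.of_le (by simp)) x).continuousAt
  | succ m ih =>
    have h : ContDiff ℝ ∞ fun p : E × ℝ =>
        (fderiv ℝ f p).comp (ContinuousLinearMap.inl ℝ E ℝ) :=
      (hf.fderiv_right (m := ∞) (by simp)).clm_comp contDiff_const
    exact contDiff_succ_iff_hasFDerivAt.2 ⟨_, ih h, fun x =>
      hasFDerivAt_intervalIntegral (hf.of_le (by simp)) x⟩

/-- Hadamard's lemma: `G x` is the mean of the derivative of `H` over the segment from `x₀` to
`x`. -/
theorem exists_contDiff_eq_add_apply_sub {H : E → ℝ} (hH : ContDiff ℝ ∞ H) (x₀ : E) :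
    ∃ G : E → E →L[ℝ] ℝ, ContDiff ℝ ∞ G ∧ G x₀ = fderiv ℝ H x₀ ∧
      ∀ x, H x = H x₀ + G x (x - x₀) := by
  refine ⟨fun x => ∫ t in (0 : ℝ)..1, fderiv ℝ H (x₀ + t • (x - x₀)), ?_, by simp, fun x => ?_⟩
  · have h : ContDiff ℝ ∞ fun p : E × ℝ => fderiv ℝ H (x₀ + p.2 • (p.1 - x₀)) :=
      (hH.fderiv_right (m := ∞) (by simp)).comp (by fun_prop)
    exact contDiff_intervalIntegral (F := E →L[ℝ] ℝ) h
  · have hcont : Continuous fun t : ℝ => fderiv ℝ H (x₀ + t • (x - x₀)) :=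
      (hH.continuous_fderiv (by simp)).comp (by fun_prop)
    have hd : ∀ t ∈ Set.uIcc (0 : ℝ) 1, HasDerivAt (fun t : ℝ => H (x₀ + t • (x - x₀)))
        (fderiv ℝ H (x₀ + t • (x - x₀)) (x - x₀)) t := fun t _ => by
      have h1 : HasDerivAt (fun t : ℝ => x₀ + t • (x - x₀)) (x - x₀) t := by
        simpa using ((hasDerivAt_id t).smul_const (x - x₀)).const_add x₀
      exact (hH.differentiable (by simp) _).hasFDerivAt.comp_hasDerivAt t h1
    have := intervalIntegral.integral_eq_sub_of_hasDerivAt hd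
      ((hcont.clm_apply continuous_const).intervalIntegrable _ _)
    rw [ContinuousLinearMap.intervalIntegral_apply (hcont.intervalIntegrable _ _), this]
    simp

end Hadamard


/-! ### Charts of a manifold and of its cotangent bundle -/

section Charts

open scoped Topology

/-- The model space `ℝⁿ`. -/
abbrev Vec (n : ℕ) : Type := EuclideanSpace ℝ (Fin n)

theorem clm_apply_eq_sum {n : ℕ} (ξ : Vec n →L[ℝ] ℝ) (v : Vec n) :
    ξ v = ∑ i, v i * ξ (EuclideanSpace.single i 1) := by
  conv_lhs => rw [← (EuclideanSpace.basisFun (Fin n) ℝ).sum_repr v, map_sum]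
  simp

theorem clm_eq_sum {n : ℕ} (ξ : Vec n →L[ℝ] ℝ) :
    ξ = ∑ i, ξ (EuclideanSpace.single i 1) • EuclideanSpace.proj (𝕜 := ℝ) i :=
  ContinuousLinearMap.ext fun v => by
    rw [clm_apply_eq_sum ξ v]
    simp [mul_comm]

variable {M : Type*} [TopologicalSpace M]

/-- A cutoff function around `q₀`, supported in the domain of the chart at `q₀`. -/
noncomputable def cutoff (n : ℕ) [ChartedSpace (Vec n) M] (q₀ : M) : SmoothBumpFunction (𝓡 n) q₀ :=
  Classical.choice inferInstance

variable {n : ℕ} [ChartedSpace (Vec n) M]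

theorem cutoff_eq_zero_or_mem (q₀ q : M) :
    cutoff n q₀ q = 0 ∨ extChartAt (𝓡 n) q₀ q ∈ (extChartAt (𝓡 n) q₀).target := by
  refine or_iff_not_imp_left.2 fun h => (extChartAt (𝓡 n) q₀).map_source ?_
  rw [extChartAt_source]
  exact (cutoff n q₀).support_subset_source h

/-- The set of all `q` satisfying this condition is a neighbourhood of `q₀` on which functions
constructed in the chart at `q₀` are not affected by the cutoff, together with all derivatives. -/
theorem eventually_cutoff_eq_one (q₀ : M) :
    ∀ᶠ q in 𝓝 q₀, q ∈ (chartAt (Vec n) q₀).source ∧ cutoff n q₀ =ᶠ[𝓝 q] 1 :=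
  Filter.Eventually.and ((chartAt (Vec n) q₀).open_source.mem_nhds (mem_chart_source _ q₀))
    (eventually_eventually_nhds.2 (cutoff n q₀).eventuallyEq_one)

variable [IsManifold (𝓡 n) ∞ M]

theorem fderiv_comp_extChartAt_symm (q₀ : M) (f : SmoothFun n M) {q : M}
    (hq : q ∈ (chartAt (Vec n) q₀).source) :
    fderiv ℝ (f ∘ (extChartAt (𝓡 n) q₀).symm) (extChartAt (𝓡 n) q₀ q) =
      (mfderiv (𝓡 n) 𝓘(ℝ, ℝ) f q).comp
        ((trivializationAt (Vec n) (TangentSpace (𝓡 n)) q₀).symmL ℝ q) := by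
  have : IsManifold (𝓡 n) 1 M := IsManifold.of_le (n := ∞) (by simp)
  have hq' : q ∈ (extChartAt (𝓡 n) q₀).source := by rwa [extChartAt_source]
  have hinv := (extChartAt (𝓡 n) q₀).left_inv hq'
  rw [TangentBundle.symmL_trivializationAt hq, ← mfderiv_eq_fderiv]
  have h1 : MDifferentiableAt 𝓘(ℝ, Vec n) (𝓡 n) (extChartAt (𝓡 n) q₀).symm
      (extChartAt (𝓡 n) q₀ q) := by
    have := mdifferentiableWithinAt_extChartAt_symm (I := 𝓡 n)
      ((extChartAt (𝓡 n) q₀).map_source hq')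
    rwa [ModelWithCorners.range_eq_univ, mdifferentiableWithinAt_univ] at this
  have h2 : MDifferentiableAt (𝓡 n) 𝓘(ℝ, ℝ) f
      ((extChartAt (𝓡 n) q₀).symm (extChartAt (𝓡 n) q₀ q)) :=
    f.contMDiff.mdifferentiable (by simp) _
  rw [mfderiv_comp _ h2 h1, ModelWithCorners.range_eq_univ, mfderivWithin_univ, hinv]
  rfl

theorem extChartAt_cotangent_source (x : CotangentBundle n M) :
    (extChartAt (cotangentModel n) x).source =
      {z : CotangentBundle n M | z.1 ∈ (chartAt (Vec n) x.1).source} := by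
  rw [FiberBundle.extChartAt]
  ext z
  simp only [mfld_simps]
  exact ⟨fun h => h.2, fun h => ⟨⟨h, Set.mem_univ _⟩, h⟩⟩

theorem extChartAt_cotangent_target (x : CotangentBundle n M) :
    (extChartAt (cotangentModel n) x).target = (extChartAt (𝓡 n) x.1).target ×ˢ Set.univ := by
  rw [FiberBundle.extChartAt_target]
  congr 1
  refine Set.inter_eq_left.2 fun u hu => ?_
  have := (extChartAt (𝓡 n) x.1).map_target hu
  rw [extChartAt_source] at this
  exact ⟨this, Set.mem_univ _⟩

theorem extChartAt_cotangent_apply (x z : CotangentBundle n M) :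
    extChartAt (cotangentModel n) x z = (extChartAt (𝓡 n) x.1 z.1,
      z.2.comp ((trivializationAt (Vec n) (TangentSpace (𝓡 n)) x.1).symmL ℝ z.1)) := by
  rw [FiberBundle.extChartAt]
  refine Prod.ext rfl ?_
  refine ContinuousLinearMap.ext fun v => ?_
  simp [hom_trivializationAt_apply, ContinuousLinearMap.inCoordinates]

/-- In canonical coordinates the section `df` of the cotangent bundle is `u ↦ (u, f'(u))`. -/
theorem extChartAt_differential (x : CotangentBundle n M) (f : SmoothFun n M) {q : M}
    (hq : q ∈ (chartAt (Vec n) x.1).source) :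
    extChartAt (cotangentModel n) x (differential f q) = (extChartAt (𝓡 n) x.1 q,
      fderiv ℝ (f ∘ (extChartAt (𝓡 n) x.1).symm) (extChartAt (𝓡 n) x.1 q)) := by
  rw [extChartAt_cotangent_apply, fderiv_comp_extChartAt_symm x.1 f hq]
  rfl

theorem contDiffOn_comp_extChartAt_symm (q₀ : M) (f : SmoothFun n M) :
    ContDiffOn ℝ ∞ (f ∘ (extChartAt (𝓡 n) q₀).symm) (extChartAt (𝓡 n) q₀).target :=
  contMDiffOn_iff_contDiffOn.1 (f.contMDiff.comp_contMDiffOn (contMDiffOn_extChartAt_symm q₀))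

theorem contDiffOn_fderiv_comp_extChartAt_symm (q₀ : M) (f : SmoothFun n M) :
    ContDiffOn ℝ ∞ (fderiv ℝ (f ∘ (extChartAt (𝓡 n) q₀).symm)) (extChartAt (𝓡 n) q₀).target :=
  (contDiffOn_comp_extChartAt_symm q₀ f).fderiv_of_isOpen (isOpen_extChartAt_target q₀) (by simp)

theorem contMDiffOn_fderiv_extChartAt (q₀ : M) (f : SmoothFun n M) :
    ContMDiffOn (𝓡 n) 𝓘(ℝ, Vec n →L[ℝ] ℝ) ∞
      (fun q => fderiv ℝ (f ∘ (extChartAt (𝓡 n) q₀).symm) (extChartAt (𝓡 n) q₀ q))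
      (chartAt (Vec n) q₀).source := by
  refine (contDiffOn_fderiv_comp_extChartAt_symm q₀ f).contMDiffOn.comp contMDiffOn_extChartAt
    fun q hq => ?_
  rw [← extChartAt_source (𝓡 n)] at hq
  exact (extChartAt (𝓡 n) q₀).map_source hq

theorem extChartAt_cotangent_smul (x : CotangentBundle n M) (t : ℝ) (q : M)
    (p : TangentSpace (𝓡 n) q →L[ℝ] ℝ) :
    extChartAt (cotangentModel n) x ⟨q, t • p⟩ =
      ((extChartAt (cotangentModel n) x ⟨q, p⟩).1,
        t • (extChartAt (cotangentModel n) x ⟨q, p⟩).2) := by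
  rw [extChartAt_cotangent_apply, extChartAt_cotangent_apply]
  rfl

variable [T2Space M]

/-- The extension by zero of `χ g`, where `χ` is the cutoff function around `q₀` and `g` is smooth
on the domain of the chart at `q₀`. -/
noncomputable def cut (q₀ : M) (g : M → ℝ)
    (hg : ContMDiffOn (𝓡 n) 𝓘(ℝ, ℝ) ∞ g (chartAt (Vec n) q₀).source) : SmoothFun n M :=
  ⟨fun q => cutoff n q₀ q • g q, (cutoff n q₀).contMDiff_smul hg⟩

theorem cut_apply (q₀ : M) (g : M → ℝ)
    (hg : ContMDiffOn (𝓡 n) 𝓘(ℝ, ℝ) ∞ g (chartAt (Vec n) q₀).source) (q : M) :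
    cut q₀ g hg q = cutoff n q₀ q * g q := rfl

theorem cut_apply_of_eq_one {q₀ : M} {g : M → ℝ}
    (hg : ContMDiffOn (𝓡 n) 𝓘(ℝ, ℝ) ∞ g (chartAt (Vec n) q₀).source) {q : M}
    (h : cutoff n q₀ q = 1) : cut q₀ g hg q = g q := by
  rw [cut_apply, h, one_mul]

/-- For a linear form `ξ` on `ℝⁿ`, the smooth function on `M` which is equal to `ξ` in the chart at
`q₀`, multiplied by a cutoff function around `q₀`. -/
noncomputable def chartLin (q₀ : M) : (Vec n →L[ℝ] ℝ) →ₗ[ℝ] SmoothFun n M where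
  toFun ξ := cut q₀ (fun q => ξ (extChartAt (𝓡 n) q₀ q))
    (ξ.contMDiff.comp_contMDiffOn contMDiffOn_extChartAt)
  map_add' _ _ := ContMDiffMap.ext fun _ => mul_add _ _ _
  map_smul' _ _ := ContMDiffMap.ext fun _ => mul_left_comm _ _ _

theorem chartLin_apply (q₀ : M) (ξ : Vec n →L[ℝ] ℝ) (q : M) :
    chartLin q₀ ξ q = cutoff n q₀ q * ξ (extChartAt (𝓡 n) q₀ q) := rfl

theorem fderiv_chartLin {q₀ q : M} (hq : q ∈ (chartAt (Vec n) q₀).source)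
    (h : cutoff n q₀ =ᶠ[𝓝 q] 1) (ξ : Vec n →L[ℝ] ℝ) :
    fderiv ℝ (chartLin q₀ ξ ∘ (extChartAt (𝓡 n) q₀).symm) (extChartAt (𝓡 n) q₀ q) = ξ := by
  have hq' : q ∈ (extChartAt (𝓡 n) q₀).source := by rwa [extChartAt_source]
  have ht := (extChartAt (𝓡 n) q₀).map_source hq'
  have hinv := (extChartAt (𝓡 n) q₀).left_inv hq'
  have hc : ContinuousAt (extChartAt (𝓡 n) q₀).symm (extChartAt (𝓡 n) q₀ q) :=
    continuousAt_extChartAt_symm'' ht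
  have he : chartLin q₀ ξ ∘ (extChartAt (𝓡 n) q₀).symm =ᶠ[𝓝 (extChartAt (𝓡 n) q₀ q)] ξ := by
    filter_upwards [hc.eventually (by rw [hinv]; exact h),
      (isOpen_extChartAt_target q₀).mem_nhds ht] with u hu hut
    rw [Function.comp_apply, chartLin_apply, hu, Pi.one_apply, one_mul,
      (extChartAt (𝓡 n) q₀).right_inv hut]
  rw [he.fderiv_eq, ξ.fderiv]

end Charts


/-! ### Operators of order at most one -/

section Derivation

variable {K A : Type*} [Field K] [CommRing A] [Algebra K A]

theorem delta_one_left (φ : Op K A) : delta K (1 : A) φ = 0 := by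
  have h : Op.mulBy K (1 : A) = 1 := Op.ext fun u => one_mul u
  rw [delta_apply, h, mul_one, one_mul, sub_self]

variable (K) in
/-- The action on functions of an operator `D` of order `≤ 1`: `a ↦ [D, a](1) = D a - a D 1`. For
operators of order `≤ 1` it is a derivation. -/
def commAtOne (D : Op K A) : A →ₗ[K] A where
  toFun a := delta K a D 1
  map_add' a b := by rw [delta_add]; rfl
  map_smul' c a := by rw [delta_smul]; rfl

theorem commAtOne_apply (D : Op K A) (a : A) : commAtOne K D a = delta K a D 1 := rfl

theorem commAtOne_one (D : Op K A) : commAtOne K D 1 = 0 := by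
  rw [commAtOne_apply, delta_one_left, Op.zero_apply]

theorem commAtOne_mul {D : Op K A} (hD : D ∈ Diff K A 1) (a b : A) :
    commAtOne K D (a * b) = commAtOne K D a * b + a * commAtOne K D b := by
  have h := eq_mulLeft_of_mem_diff_zero (mem_diffLT_succ.1 hD a)
  have h' : delta K a D b = delta K a D 1 * b := by
    rw [h, Op.mulBy_apply, Op.mulBy_apply, mul_one]
  simp only [commAtOne_apply]
  rw [delta_mul_left]
  change delta K a D (b * 1) + a * delta K b D 1 = _
  rw [mul_one, h']

end Derivation

section PointDerivation

open scoped Topology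

variable {n : ℕ} {M : Type*} [TopologicalSpace M] [ChartedSpace (Vec n) M]

theorem commAtOne_eq_zero_of_eq_mul {D : Op ℝ (SmoothFun n M)}
    (hD : D ∈ Diff ℝ (SmoothFun n M) 1) {a b : SmoothFun n M} {q : M} (ha : a q = 0)
    (hb : b q = 0) : commAtOne ℝ D (a * b) q = 0 := by
  rw [commAtOne_mul hD]
  change commAtOne ℝ D a q * b q + a q * commAtOne ℝ D b q = 0
  rw [ha, hb, mul_zero, zero_mul, add_zero]

variable [IsManifold (𝓡 n) ∞ M]

/-- A function on a chart which agrees with `f` near the centre and is smooth on all of `ℝⁿ`. -/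
theorem exists_contDiff_eventuallyEq (q : M) (f : SmoothFun n M) :
    ∃ H : Vec n → ℝ, ContDiff ℝ ∞ H ∧
      H =ᶠ[𝓝 (extChartAt (𝓡 n) q q)] f ∘ (extChartAt (𝓡 n) q).symm := by
  let χ := (cutoff n q).toContDiffBump
  have hsub : tsupport χ ⊆ (extChartAt (𝓡 n) q).target := by
    rw [χ.tsupport_eq]
    intro u hu
    exact (cutoff n q).closedBall_subset ⟨hu, by simp⟩
  refine ⟨fun u => χ u • (f ∘ (extChartAt (𝓡 n) q).symm) u, ?_, ?_⟩
  · refine contDiff_iff_contDiffAt.2 fun u => ?_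
    by_cases hu : u ∈ tsupport χ
    · exact χ.contDiff.contDiffAt.smul ((contDiffOn_comp_extChartAt_symm q f).contDiffAt
        ((isOpen_extChartAt_target q).mem_nhds (hsub hu)))
    · refine contDiffAt_const (c := (0 : ℝ)) |>.congr_of_eventuallyEq ?_
      filter_upwards [(isClosed_tsupport χ).isOpen_compl.mem_nhds hu] with y hy
      rw [image_eq_zero_of_notMem_tsupport hy, zero_smul]
  · filter_upwards [χ.eventuallyEq_one] with u hu
    rw [hu, Pi.one_apply, one_smul]

variable [T2Space M]

/-- Locality: a function vanishing near `q` is a product of two functions vanishing at `q`, one of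
them being `1 - ψ` for a bump function `ψ`. -/
theorem commAtOne_eq_zero_of_eventuallyEq {D : Op ℝ (SmoothFun n M)}
    (hD : D ∈ Diff ℝ (SmoothFun n M) 1) {r : SmoothFun n M} {q : M} (hr : r =ᶠ[𝓝 q] 0) :
    commAtOne ℝ D r q = 0 := by
  obtain ⟨ψ, -, hψ⟩ := ((SmoothBumpFunction.nhds_basis_tsupport (I := 𝓡 n) q).mem_iff).1 hr
  let w : SmoothFun n M := ⟨fun x => 1 - ψ x, contMDiff_const.sub ψ.contMDiff⟩
  have hw : r = w * r := ContMDiffMap.ext fun x => by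
    change r x = (1 - ψ x) * r x
    by_cases hx : x ∈ tsupport ψ
    · have : r x = 0 := hψ hx
      rw [this, mul_zero]
    · rw [image_eq_zero_of_notMem_tsupport hx, sub_zero, one_mul]
  rw [hw]
  refine commAtOne_eq_zero_of_eq_mul hD ?_ hr.self_of_nhds
  change 1 - ψ q = 0
  rw [ψ.eq_one, sub_self]

/-- By Hadamard's lemma a function with zero differential at `q` is, near `q`, a constant plus a sum
of products of functions vanishing at `q`; so a derivation at `q` kills it. -/
theorem commAtOne_eq_zero_of_mfderiv_eq_zero {D : Op ℝ (SmoothFun n M)}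
    (hD : D ∈ Diff ℝ (SmoothFun n M) 1) {h : SmoothFun n M} {q : M}
    (hq : mfderiv (𝓡 n) 𝓘(ℝ, ℝ) h q = 0) : commAtOne ℝ D h q = 0 := by
  obtain ⟨H, hH, hHe⟩ := exists_contDiff_eventuallyEq q h
  obtain ⟨G, hG, hG0, hHG⟩ := exists_contDiff_eq_add_apply_sub hH (extChartAt (𝓡 n) q q)
  have hqs := mem_chart_source (Vec n) q
  rw [hHe.fderiv_eq, fderiv_comp_extChartAt_symm q h hqs, hq, ContinuousLinearMap.zero_comp] at hG0
  replace hG0 : G (extChartAt (𝓡 n) q q) = (0 : Vec n →L[ℝ] ℝ) := hG0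
  -- Near `q`, `h = h q + ∑ i, a i * b i`, with `a i` the coordinates centred at `q` and `b i` the
  -- coefficients of Hadamard's lemma.
  let a (i : Fin n) : SmoothFun n M :=
    cut q (fun x => (extChartAt (𝓡 n) q x - extChartAt (𝓡 n) q q) i)
      ((by fun_prop : ContDiff ℝ ∞ fun u : Vec n => (u - extChartAt (𝓡 n) q q) i).contMDiff
        |>.comp_contMDiffOn contMDiffOn_extChartAt)
  let b (i : Fin n) : SmoothFun n M :=
    cut q (fun x => G (extChartAt (𝓡 n) q x) (EuclideanSpace.single i 1))
      ((hG.clm_apply contDiff_const).contMDiff.comp_contMDiffOn contMDiffOn_extChartAt)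
  have ha (i) : a i q = 0 := by simp [a, cut_apply]
  have hb (i) : b i q = 0 := by
    simp only [b, cut_apply]
    rw [hG0, zero_apply, mul_zero]
  have hsum : ∀ (s : Finset (Fin n)) (x : M), (∑ i ∈ s, a i * b i : SmoothFun n M) x =
      ∑ i ∈ s, a i x * b i x := fun s x =>
    map_sum (ContMDiffMap.evalRingHom x) _ _
  have hr : (h - (h q • 1 + ∑ i, a i * b i) : SmoothFun n M) =ᶠ[𝓝 q] 0 := by
    filter_upwards [eventually_cutoff_eq_one (n := n) q,
      (continuousAt_extChartAt (I := 𝓡 n) q).eventually hHe] with x hx hHx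
    have hxs : x ∈ (extChartAt (𝓡 n) q).source := by rw [extChartAt_source]; exact hx.1
    have h1 : cutoff n q x = 1 := hx.2.self_of_nhds
    change h x - (h q * 1 + (∑ i, a i * b i : SmoothFun n M) x) = 0
    rw [hsum, Function.comp_apply, (extChartAt (𝓡 n) q).left_inv hxs] at *
    have hHq : H (extChartAt (𝓡 n) q q) = h q := by
      rw [hHe.self_of_nhds, Function.comp_apply, extChartAt_to_inv]
    rw [← hHx, hHG, hHq]
    rw [clm_apply_eq_sum]
    simp only [a, b, cut_apply_of_eq_one _ h1]
    simp
  have h1 := commAtOne_eq_zero_of_eventuallyEq hD hr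
  rw [map_sub, map_add, map_smul, map_sum, commAtOne_one, smul_zero, zero_add] at h1
  have h2 : (∑ i, commAtOne ℝ D (a i * b i) : SmoothFun n M) q = 0 := by
    refine (map_sum (ContMDiffMap.evalRingHom q) _ _).trans (Finset.sum_eq_zero fun i _ => ?_)
    exact commAtOne_eq_zero_of_eq_mul hD (ha i) (hb i)
  change commAtOne ℝ D h q - (∑ i, commAtOne ℝ D (a i * b i) : SmoothFun n M) q = 0 at h1
  rwa [h2, sub_zero] at h1

end PointDerivation


/-! ### The symbol as a function on the cotangent bundle -/

section SymbolFunction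

open scoped Topology

variable {n : ℕ} {M : Type*} [TopologicalSpace M] [ChartedSpace (Vec n) M]

theorem differential_eq_iff {f g : SmoothFun n M} {q : M} :
    differential f q = differential g q ↔
      mfderiv (𝓡 n) 𝓘(ℝ, ℝ) f q = mfderiv (𝓡 n) 𝓘(ℝ, ℝ) g q :=
  (Bundle.TotalSpace.mk_inj (E := fun q : M => TangentSpace (𝓡 n) q →L[ℝ] ℝ))

/-- For a fixed operator `Δ` and a linear family `L` of functions, `(δ_{L ξ}^k Δ)(1)(q)` is a
polynomial in the coordinates of `ξ` with smooth functions of `q` as coefficients. -/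
theorem contMDiffAt_delta_pow {N E' H' : Type*} [TopologicalSpace N] [NormedAddCommGroup E']
    [NormedSpace ℝ E'] [TopologicalSpace H'] [ChartedSpace H' N] {J : ModelWithCorners ℝ E' H'}
    {π : N → M} {ξ : N → Vec n →L[ℝ] ℝ} {z₀ : N} (hπ : ContMDiffAt J (𝓡 n) ∞ π z₀)
    (hξ : ContMDiffAt J 𝓘(ℝ, Vec n →L[ℝ] ℝ) ∞ ξ z₀)
    (L : (Vec n →L[ℝ] ℝ) →ₗ[ℝ] SmoothFun n M) (k : ℕ) (Δ : Op ℝ (SmoothFun n M)) :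
    ContMDiffAt J 𝓘(ℝ, ℝ) ∞ (fun z => (delta ℝ (L (ξ z)) ^ k) Δ 1 (π z)) z₀ := by
  induction k generalizing Δ with
  | zero => exact (Δ 1).contMDiff.contMDiffAt.comp z₀ hπ
  | succ k ih =>
    have h : (fun z => (delta ℝ (L (ξ z)) ^ (k + 1)) Δ 1 (π z)) = fun z =>
        ∑ i, ξ z (EuclideanSpace.single i 1) *
          (delta ℝ (L (ξ z)) ^ k) (delta ℝ (L (EuclideanSpace.proj i)) Δ) 1 (π z) := by
      funext z
      have h1 : delta ℝ (L (ξ z)) Δ = ∑ i, ξ z (EuclideanSpace.single i 1) •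
          delta ℝ (L (EuclideanSpace.proj i)) Δ := by
        conv_lhs => rw [clm_eq_sum (ξ z), map_sum]
        change deltaHom ℝ _ Δ = _
        rw [map_sum, LinearMap.sum_apply]
        refine Finset.sum_congr rfl fun i _ => ?_
        rw [map_smul, map_smul]
        rfl
      rw [pow_succ, Module.End.mul_apply, h1, map_sum]
      let ev : Op ℝ (SmoothFun n M) →+ ℝ :=
        { toFun := fun φ => φ 1 (π z)
          map_zero' := rfl
          map_add' := fun _ _ => rfl }
      refine (map_sum ev _ _).trans (Finset.sum_congr rfl fun i _ => ?_)
      rw [map_smul]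
      rfl
    rw [h]
    refine contMDiffAt_finsetSum fun i _ => ?_
    refine ContMDiffAt.mul (I := 𝓘(ℝ, ℝ)) ?_ (ih _)
    exact (ContinuousLinearMap.apply ℝ ℝ
      (EuclideanSpace.single i (1 : ℝ))).contMDiff.contMDiffAt.comp z₀ hξ

variable [IsManifold (𝓡 n) ∞ M]

/-- The linear form on `ℝⁿ` representing the covector `z` in the chart of `M` at `q₀`. -/
noncomputable def covec (q₀ : M) (z : CotangentBundle n M) : Vec n →L[ℝ] ℝ :=
  z.2.comp ((trivializationAt (Vec n) (TangentSpace (𝓡 n)) q₀).symmL ℝ z.1)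

theorem covec_differential (q₀ : M) (f : SmoothFun n M) {q : M}
    (hq : q ∈ (chartAt (Vec n) q₀).source) :
    covec q₀ (differential f q) =
      fderiv ℝ (f ∘ (extChartAt (𝓡 n) q₀).symm) (extChartAt (𝓡 n) q₀ q) :=
  (fderiv_comp_extChartAt_symm q₀ f hq).symm

theorem contMDiffAt_covec (z₀ : CotangentBundle n M) :
    ContMDiffAt (cotangentModel n) 𝓘(ℝ, Vec n →L[ℝ] ℝ) ∞ (covec z₀.1) z₀ := by
  have h := contMDiffAt_extChartAt (I := cotangentModel n) (n := ∞) (x := z₀)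
  have h2 : (covec z₀.1) = fun z => (extChartAt (cotangentModel n) z₀ z).2 := funext fun z => by
    rw [extChartAt_cotangent_apply]; rfl
  rw [h2]
  exact (ContinuousLinearMap.snd ℝ (Vec n) (Vec n →L[ℝ] ℝ)).contMDiff.contMDiffAt.comp z₀ h

theorem extChartAt_cotangent_eq (x z : CotangentBundle n M) :
    extChartAt (cotangentModel n) x z = (extChartAt (𝓡 n) x.1 z.1, covec x.1 z) :=
  extChartAt_cotangent_apply x z

variable [T2Space M]

theorem differential_chartLin_covec {q₀ : M} {z : CotangentBundle n M}
    (hq : z.1 ∈ (chartAt (Vec n) q₀).source) (h : cutoff n q₀ =ᶠ[𝓝 z.1] 1) :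
    differential (chartLin q₀ (covec q₀ z)) z.1 = z := by
  have hs : ∀ w : CotangentBundle n M, w.1 = z.1 →
      w ∈ (extChartAt (cotangentModel n) (⟨q₀, 0⟩ : CotangentBundle n M)).source := by
    intro w hw
    rw [extChartAt_cotangent_source]
    change w.1 ∈ (chartAt (Vec n) q₀).source
    rwa [hw]
  refine (extChartAt (cotangentModel n) (⟨q₀, 0⟩ : CotangentBundle n M)).injOn
    (hs (differential _ z.1) rfl) (hs z rfl) ?_
  rw [extChartAt_cotangent_eq, extChartAt_cotangent_eq]
  exact Prod.ext rfl ((covec_differential q₀ _ hq).trans (fderiv_chartLin hq h _))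

/-- Every covector is a differential. -/
theorem exists_differential_eq (z : CotangentBundle n M) :
    ∃ f : SmoothFun n M, differential f z.1 = z := by
  obtain ⟨h1, h2⟩ := (eventually_cutoff_eq_one (n := n) z.1).self_of_nhds
  exact ⟨_, differential_chartLin_covec h1 h2⟩

/-- The symbol at `q` depends only on the differential at `q`. The difference
`δ_f^k Δ - δ_g^k Δ` is `δ_{f-g}` applied to an operator of order `≤ 1`, and `f - g` has zero
differential at `q`. -/
theorem symb_congr {k : ℕ} {Δ : Op ℝ (SmoothFun n M)} (hΔ : Δ ∈ Diff ℝ (SmoothFun n M) k)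
    {f g : SmoothFun n M} {q : M} (h : differential f q = differential g q) :
    symb k f Δ q = symb k g Δ q := by
  have hd : mfderiv (𝓡 n) 𝓘(ℝ, ℝ) (f - g : SmoothFun n M) q = 0 := by
    change mfderiv (𝓡 n) 𝓘(ℝ, ℝ) (⇑f - ⇑g) q = 0
    rw [mfderiv_sub (f.contMDiff.mdifferentiable (by simp) q)
      (g.contMDiff.mdifferentiable (by simp) q)]
    exact sub_eq_zero.2 (differential_eq_iff.1 h)
  have hc := (delta_commute (K := ℝ) f g).mul_geom_sum₂ k
  have hfg : delta ℝ (f - g) = delta ℝ f - delta ℝ g := map_sub (deltaHom ℝ) f g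
  have hmem : (∑ i ∈ Finset.range k, delta ℝ f ^ i * delta ℝ g ^ (k - 1 - i)) Δ ∈
      Diff ℝ (SmoothFun n M) 1 := by
    rw [LinearMap.sum_apply]
    refine sum_mem fun i hi => ?_
    rw [Finset.mem_range] at hi
    rw [Module.End.mul_apply]
    refine delta_pow_mem f i (delta_pow_mem g _ ?_)
    rwa [show 1 + 1 + i + (k - 1 - i) = k + 1 by omega]
  have h0 := commAtOne_eq_zero_of_mfderiv_eq_zero hmem hd
  rw [commAtOne_apply, hfg, ← Module.End.mul_apply, hc, LinearMap.sub_apply, Op.sub_apply] at h0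
  have h1 : (((delta ℝ f ^ k) Δ 1 : SmoothFun n M) q) = ((delta ℝ g ^ k) Δ 1 : SmoothFun n M) q :=
    sub_eq_zero.1 h0
  exact congrArg (fun r => (k.factorial : ℝ)⁻¹ * r) h1

/-- The symbol of order `k` of an operator, as a function on the cotangent bundle: its value at a
covector `z` is the symbol along a function with differential `z`, for which a function that is
linear in a chart is taken. -/
noncomputable def symbFun (k : ℕ) (Δ : Op ℝ (SmoothFun n M)) (z : CotangentBundle n M) : ℝ :=
  symb k (chartLin z.1 (covec z.1 z)) Δ z.1

theorem symbFun_differential {k : ℕ} {Δ : Op ℝ (SmoothFun n M)}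
    (hΔ : Δ ∈ Diff ℝ (SmoothFun n M) k) (f : SmoothFun n M) (q : M) :
    symbFun k Δ (differential f q) = symb k f Δ q := by
  obtain ⟨h1, h2⟩ := (eventually_cutoff_eq_one (n := n) q).self_of_nhds
  exact symb_congr hΔ (differential_chartLin_covec (z := differential f q) h1 h2)

theorem contMDiff_symbFun {k : ℕ} {Δ : Op ℝ (SmoothFun n M)}
    (hΔ : Δ ∈ Diff ℝ (SmoothFun n M) k) :
    ContMDiff (cotangentModel n) 𝓘(ℝ, ℝ) ∞ (symbFun k Δ) := by
  intro z₀
  have hproj : ContMDiffAt (cotangentModel n) (𝓡 n) ∞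
      (Bundle.TotalSpace.proj : CotangentBundle n M → M) z₀ := Bundle.contMDiffAt_proj _
  -- Near `z₀` the symbol may be computed with functions that are linear in the fixed chart at the
  -- base point of `z₀`, instead of the chart at the base point of `z`.
  refine (ContMDiffAt.mul (I := 𝓘(ℝ, ℝ)) (contMDiffAt_const (c := (k.factorial : ℝ)⁻¹))
    (contMDiffAt_delta_pow hproj (contMDiffAt_covec z₀) (chartLin z₀.1) k
      Δ)).congr_of_eventuallyEq ?_
  filter_upwards [hproj.continuousAt.eventually (eventually_cutoff_eq_one (n := n) z₀.1)] with z hz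
  conv_lhs => rw [← differential_chartLin_covec hz.1 hz.2]
  exact symbFun_differential hΔ _ _

/-- The restriction of the symbol to a fibre, as a multilinear form:
`(p_1, …, p_k) ↦ (1 / k!) (δ_{f_1} ⋯ δ_{f_k} Δ)(1)(q)`, where `f_i` is linear in the chart at `q`
with differential `p_i` at `q`. -/
noncomputable def symbForm (k : ℕ) (Δ : Op ℝ (SmoothFun n M)) (q : M) :
    MultilinearMap ℝ (fun _ : Fin k => TangentSpace (𝓡 n) q →L[ℝ] ℝ) ℝ :=
  let lin : (TangentSpace (𝓡 n) q →L[ℝ] ℝ) →ₗ[ℝ] (Vec n →L[ℝ] ℝ) :=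
    { toFun := fun p => covec q ⟨q, p⟩
      map_add' := fun _ _ => rfl
      map_smul' := fun _ _ => rfl }
  let ev : Module.End ℝ (Op ℝ (SmoothFun n M)) →ₗ[ℝ] ℝ :=
    { toFun := fun T => (k.factorial : ℝ)⁻¹ * T Δ 1 q
      map_add' := fun _ _ => mul_add _ _ _
      map_smul' := fun _ _ => mul_left_comm _ _ _ }
  ev.compMultilinearMap ((MultilinearMap.mkPiAlgebraFin ℝ k _).compLinearMap
    fun _ => (deltaHom ℝ).comp ((chartLin q).comp lin))

theorem symbFun_eq_symbForm (k : ℕ) (Δ : Op ℝ (SmoothFun n M)) (q : M)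
    (p : TangentSpace (𝓡 n) q →L[ℝ] ℝ) : symbFun k Δ ⟨q, p⟩ = symbForm k Δ q fun _ => p := by
  simp only [symbForm, LinearMap.compMultilinearMap_apply, MultilinearMap.compLinearMap_apply,
    MultilinearMap.mkPiAlgebraFin_apply_const]
  rfl

/-- The symbol map `σ_k : Diff_k(M) → P_k(T*M)`. -/
noncomputable def symbolMap (n : ℕ) (M : Type*) [TopologicalSpace M] [ChartedSpace (Vec n) M]
    [IsManifold (𝓡 n) ∞ M] [T2Space M] (k : ℕ) :
    Diff ℝ (SmoothFun n M) k →ₗ[ℝ] fibrePoly n M k where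
  toFun Δ := ⟨⟨symbFun k Δ.1, contMDiff_symbFun Δ.2⟩, fun q =>
    ⟨symbForm k Δ.1 q, symbFun_eq_symbForm k Δ.1 q⟩⟩
  map_add' Δ Δ' := Subtype.ext <| ContMDiffMap.ext fun z =>
    congrArg (fun a : SmoothFun n M => a z.1) (symb_add k _ Δ.1 Δ'.1)
  map_smul' c Δ := Subtype.ext <| ContMDiffMap.ext fun z =>
    congrArg (fun a : SmoothFun n M => a z.1) (symb_smul k _ c Δ.1)

theorem symbolMap_differential {k : ℕ} (Δ : Diff ℝ (SmoothFun n M) k) (f : SmoothFun n M) (q : M) :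
    (symbolMap n M k Δ).1 (differential f q) = symb k f Δ.1 q :=
  symbFun_differential Δ.2 f q

theorem isSymbol_symbolMap {k : ℕ} (Δ : Diff ℝ (SmoothFun n M) k) :
    IsSymbol k Δ.1 (symbolMap n M k Δ).1 :=
  symbolMap_differential Δ

theorem cotangentFun_ext {F G : CotangentFun n M}
    (h : ∀ (f : SmoothFun n M) (q : M), F (differential f q) = G (differential f q)) : F = G :=
  ContMDiffMap.ext fun z => by
    obtain ⟨f, hf⟩ := exists_differential_eq z
    rw [← hf]
    exact h f z.1

/-- Exactness in the middle: the kernel of `σ_k` is `Diff_{k-1}(M)`. -/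
theorem symbolMap_eq_zero_iff {k : ℕ} (Δ : Diff ℝ (SmoothFun n M) k) :
    symbolMap n M k Δ = 0 ↔ Δ.1 ∈ diffLT ℝ (SmoothFun n M) k := by
  constructor
  · intro h
    refine mem_diffLT_of_symb_eq_zero Δ.2 fun f => ContMDiffMap.ext fun q => ?_
    rw [← symbolMap_differential, h]
    rfl
  · intro h
    refine Subtype.ext (cotangentFun_ext fun f q => ?_)
    rw [symbolMap_differential, symb_eq_zero f h]
    rfl

end SymbolFunction


/-! ### The symbol of a commutator -/

section Bracket

open scoped Topology

variable {n : ℕ} {M : Type*} [TopologicalSpace M] [ChartedSpace (Vec n) M]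

/-- The derivative of the symbol along the fibre, in the direction of `da`. -/
theorem hasDerivAt_symb (k : ℕ) (Δ : Op ℝ (SmoothFun n M)) (f a : SmoothFun n M) (q : M) :
    HasDerivAt (fun t : ℝ => symb k (t • a + f) Δ q) (commAtOne ℝ (dpowPred k f Δ) a q) 0 := by
  rcases k with - | k
  · have h : (fun t : ℝ => symb 0 (t • a + f) Δ q) = fun _ => Δ 1 q := funext fun t => by
      rw [symb, dpow_zero]
    have h0 : commAtOne ℝ (dpowPred 0 f Δ) a q = 0 := by
      rw [commAtOne_apply, dpowPred, map_zero]
      rfl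
    rw [h, h0]
    exact hasDerivAt_const _ _
  · let c (j : ℕ) : ℝ := dpow j a (dpow (k + 1 - j) f Δ) 1 q
    have h : (fun t : ℝ => symb (k + 1) (t • a + f) Δ q) =
        fun t => ∑ j ∈ Finset.range (k + 2), t ^ j * c j := funext fun t => by
      rw [symb, dpow_add_smul]
      let ev : Op ℝ (SmoothFun n M) →+ ℝ :=
        { toFun := fun φ => φ 1 q
          map_zero' := rfl
          map_add' := fun _ _ => rfl }
      exact map_sum ev _ _
    have hc : commAtOne ℝ (dpowPred (k + 1) f Δ) a q = c 1 := by
      simp [commAtOne_apply, dpowPred, c, dpow]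
    have hd : HasDerivAt (fun t : ℝ => ∑ j ∈ Finset.range (k + 2), t ^ j * c j)
        (∑ j ∈ Finset.range (k + 2), (j : ℝ) * 0 ^ (j - 1) * c j) 0 :=
      HasDerivAt.fun_sum fun j _ => (hasDerivAt_pow j 0).mul_const (c j)
    rw [h, hc]
    convert hd using 1
    rw [Finset.sum_eq_single 1]
    · simp
    · intro j _ hj
      rcases j with - | - | j
      · simp
      · exact absurd rfl hj
      · simp
    · intro h1
      exact absurd (Finset.mem_range.2 (by omega)) h1

variable [IsManifold (𝓡 n) ∞ M]

theorem contDiffOn_comp_extChartAt_cotangent_symm (x : CotangentBundle n M)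
    {F : CotangentBundle n M → ℝ} (hF : ContMDiff (cotangentModel n) 𝓘(ℝ, ℝ) ∞ F) :
    ContDiffOn ℝ ∞ (F ∘ (extChartAt (cotangentModel n) x).symm)
      (extChartAt (cotangentModel n) x).target :=
  contMDiffOn_iff_contDiffOn.1 (hF.comp_contMDiffOn (contMDiffOn_extChartAt_symm x))

theorem differentiableAt_comp_extChartAt_cotangent_symm (x : CotangentBundle n M)
    {F : CotangentBundle n M → ℝ} (hF : ContMDiff (cotangentModel n) 𝓘(ℝ, ℝ) ∞ F) :
    DifferentiableAt ℝ (F ∘ (extChartAt (cotangentModel n) x).symm)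
      (extChartAt (cotangentModel n) x x) :=
  ((contDiffOn_comp_extChartAt_cotangent_symm x hF).contDiffAt
    (extChartAt_target_mem_nhds x)).differentiableAt (by simp)

theorem comp_extChartAt_cotangent_symm_differential (x : CotangentBundle n M)
    (F : CotangentBundle n M → ℝ) (f : SmoothFun n M) {q : M}
    (hq : q ∈ (chartAt (Vec n) x.1).source) :
    (F ∘ (extChartAt (cotangentModel n) x).symm) (extChartAt (𝓡 n) x.1 q,
      fderiv ℝ (f ∘ (extChartAt (𝓡 n) x.1).symm) (extChartAt (𝓡 n) x.1 q)) =
      F (differential f q) := by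
  rw [← extChartAt_differential x f hq, Function.comp_apply,
    (extChartAt (cotangentModel n) x).left_inv]
  rw [extChartAt_cotangent_source]
  exact hq

theorem differentiableAt_comp_symm (q₀ : M) (f : SmoothFun n M) {u : Vec n}
    (hu : u ∈ (extChartAt (𝓡 n) q₀).target) :
    DifferentiableAt ℝ (f ∘ (extChartAt (𝓡 n) q₀).symm) u :=
  ((contDiffOn_comp_extChartAt_symm q₀ f).contDiffAt
    ((isOpen_extChartAt_target q₀).mem_nhds hu)).differentiableAt (by simp)

theorem fderiv_comp_symm_add (q₀ : M) (f g : SmoothFun n M) {u : Vec n}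
    (hu : u ∈ (extChartAt (𝓡 n) q₀).target) :
    fderiv ℝ ((f + g : SmoothFun n M) ∘ (extChartAt (𝓡 n) q₀).symm) u =
      fderiv ℝ (f ∘ (extChartAt (𝓡 n) q₀).symm) u +
        fderiv ℝ (g ∘ (extChartAt (𝓡 n) q₀).symm) u :=
  fderiv_add (differentiableAt_comp_symm q₀ f hu) (differentiableAt_comp_symm q₀ g hu)

theorem fderiv_comp_symm_smul (q₀ : M) (t : ℝ) (f : SmoothFun n M) {u : Vec n}
    (hu : u ∈ (extChartAt (𝓡 n) q₀).target) :
    fderiv ℝ ((t • f : SmoothFun n M) ∘ (extChartAt (𝓡 n) q₀).symm) u =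
      t • fderiv ℝ (f ∘ (extChartAt (𝓡 n) q₀).symm) u :=
  fderiv_const_smul (differentiableAt_comp_symm q₀ f hu) t

variable [T2Space M]

/-- The operator `δ_f^{k-1} Δ / (k-1)!` acts on functions as the derivative of the symbol of `Δ`
along the fibre, at the covector `df`. -/
theorem commAtOne_dpowPred {k : ℕ} {Δ : Op ℝ (SmoothFun n M)}
    (hΔ : Δ ∈ Diff ℝ (SmoothFun n M) k) (f a : SmoothFun n M) (q : M) :
    commAtOne ℝ (dpowPred k f Δ) a q = ∑ i, partialP i (symbFun k Δ) (differential f q) *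
      fderiv ℝ (a ∘ (extChartAt (𝓡 n) q).symm) (extChartAt (𝓡 n) q q)
        (EuclideanSpace.single i 1) := by
  set x := differential f q with hx
  set φ := extChartAt (𝓡 n) q
  set η := fderiv ℝ (a ∘ φ.symm) (φ q) with hη
  set ξ := fderiv ℝ (f ∘ φ.symm) (φ q) with hξ
  have hqs : q ∈ (chartAt (Vec n) x.1).source := mem_chart_source (Vec n) q
  have hxξ : extChartAt (cotangentModel n) x x = (φ q, ξ) := extChartAt_differential x f hqs
  have hline : HasDerivAt (fun t : ℝ => ((φ q, t • η + ξ) : Vec n × (Vec n →L[ℝ] ℝ))) (0, η) 0 := by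
    refine (hasDerivAt_const _ _).prodMk ?_
    simpa using ((hasDerivAt_id (0 : ℝ)).smul_const η).add_const ξ
  have hF := (differentiableAt_comp_extChartAt_cotangent_symm x (contMDiff_symbFun hΔ)).hasFDerivAt
  rw [hxξ] at hF
  have hF' := HasFDerivAt.comp_hasDerivAt_of_eq (0 : ℝ) hF hline (by simp)
  have h1 : (fun t : ℝ => symb k (t • a + f) Δ q) =
      (symbFun k Δ ∘ (extChartAt (cotangentModel n) x).symm) ∘ fun t : ℝ => (φ q, t • η + ξ) := by
    funext t
    rw [← symbFun_differential hΔ, Function.comp_apply,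
      ← comp_extChartAt_cotangent_symm_differential x (symbFun k Δ) (t • a + f) hqs, hη, hξ,
      ← fderiv_comp_symm_smul q t a (mem_extChartAt_target q),
      ← fderiv_comp_symm_add q (t • a) f (mem_extChartAt_target q)]
    rfl
  have h2 := hasDerivAt_symb k Δ f a q
  rw [h1] at h2
  rw [h2.unique hF']
  have h3 : ((0, η) : Vec n × (Vec n →L[ℝ] ℝ)) =
      ∑ i, η (EuclideanSpace.single i 1) • (0, EuclideanSpace.proj i) := by
    refine Prod.ext ?_ ?_
    · rw [Prod.fst_sum]
      simp
    · rw [Prod.snd_sum]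
      exact clm_eq_sum η
  rw [h3, map_sum]
  refine Finset.sum_congr rfl fun i _ => ?_
  rw [map_smul, smul_eq_mul, mul_comm, partialP, hxξ]

/-- The section `d(chartLin q₀ ξ)` is constant in the chart of the cotangent bundle. Hence the
partial derivatives of the pullback of the symbol along it are the partial derivatives of the
symbol in the directions of the base. -/
theorem fderiv_symb_chartLin {k : ℕ} {Δ : Op ℝ (SmoothFun n M)}
    (hΔ : Δ ∈ Diff ℝ (SmoothFun n M) k) (x : CotangentBundle n M) (i : Fin n) :
    fderiv ℝ ((symb k (chartLin x.1 (covec x.1 x)) Δ : SmoothFun n M) ∘ (extChartAt (𝓡 n) x.1).symm)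
      (extChartAt (𝓡 n) x.1 x.1) (EuclideanSpace.single i 1) = partialQ i (symbFun k Δ) x := by
  set φ := extChartAt (𝓡 n) x.1
  set ξ := covec x.1 x
  have hxξ : extChartAt (cotangentModel n) x x = (φ x.1, ξ) := extChartAt_cotangent_eq x x
  have hF := (differentiableAt_comp_extChartAt_cotangent_symm x (contMDiff_symbFun hΔ)).hasFDerivAt
  rw [hxξ] at hF
  have h1 : (symb k (chartLin x.1 ξ) Δ : SmoothFun n M) ∘ φ.symm =ᶠ[𝓝 (φ x.1)]
      (symbFun k Δ ∘ (extChartAt (cotangentModel n) x).symm) ∘ fun u => (u, ξ) := by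
    have hc : Filter.Tendsto φ.symm (𝓝 (φ x.1)) (𝓝 x.1) := by
      have := continuousAt_extChartAt_symm (I := 𝓡 n) x.1
      rwa [ContinuousAt, extChartAt_to_inv] at this
    filter_upwards [hc.eventually (eventually_cutoff_eq_one (n := n) x.1),
      extChartAt_target_mem_nhds (I := 𝓡 n) x.1] with u hu hut
    have := comp_extChartAt_cotangent_symm_differential x (symbFun k Δ) (chartLin x.1 ξ) hu.1
    rw [fderiv_chartLin hu.1 hu.2, φ.right_inv hut, symbFun_differential hΔ] at this
    exact this.symm
  rw [h1.fderiv_eq, (hF.comp (φ x.1) (hasFDerivAt_prodMk_left (φ x.1) ξ)).fderiv, partialQ, hxξ]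
  rfl

/-- The symbol of a commutator is the canonical bracket of the symbols. At a given covector `x`,
both sides are computed with the function of differential `x` that is linear in the chart. -/
theorem symbFun_commutator {k l : ℕ} {Δ Δ' : Op ℝ (SmoothFun n M)}
    (hΔ : Δ ∈ Diff ℝ (SmoothFun n M) k) (hΔ' : Δ' ∈ Diff ℝ (SmoothFun n M) l)
    (x : CotangentBundle n M) :
    symbFun (k + l - 1) (Δ * Δ' - Δ' * Δ) x =
      canonicalBracket (symbFun k Δ) (symbFun l Δ') x := by
  obtain ⟨h1, h2⟩ := (eventually_cutoff_eq_one (n := n) x.1).self_of_nhds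
  have hx := differential_chartLin_covec h1 h2
  have hA := commAtOne_dpowPred hΔ (chartLin x.1 (covec x.1 x))
    (symb l (chartLin x.1 (covec x.1 x)) Δ') x.1
  have hB := commAtOne_dpowPred hΔ' (chartLin x.1 (covec x.1 x))
    (symb k (chartLin x.1 (covec x.1 x)) Δ) x.1
  have hS := congrArg (fun a : SmoothFun n M => a x.1)
    (symb_commutator (chartLin x.1 (covec x.1 x)) hΔ hΔ')
  refine hS.trans ?_
  change (commAtOne ℝ (dpowPred k _ Δ) _ : SmoothFun n M) x.1 -
    (commAtOne ℝ (dpowPred l _ Δ') _ : SmoothFun n M) x.1 = _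
  rw [hA, hB, hx, canonicalBracket, ← Finset.sum_sub_distrib]
  refine Finset.sum_congr rfl fun i _ => ?_
  rw [fderiv_symb_chartLin hΔ, fderiv_symb_chartLin hΔ', mul_comm (partialQ i (symbFun k Δ) x)]

end Bracket


/-! ### Homogeneous functions of a covector -/

section Surjectivity

open scoped Topology

/-- The function `g(u, ξ)` is smooth for `u ∈ U` and homogeneous of degree `k` in `ξ`. Homogeneity
is required only for `t ≠ 0`, so that it passes to fibre derivatives by division by `t`;
smoothness takes care of `ξ = 0`. -/
structure IsFibreHomogeneous {n : ℕ} (U : Set (Vec n)) (k : ℕ)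
    (g : Vec n × (Vec n →L[ℝ] ℝ) → ℝ) : Prop where
  contDiffOn : ContDiffOn ℝ ∞ g (U ×ˢ Set.univ)
  map_smul : ∀ u ∈ U, ∀ ξ, ∀ t : ℝ, t ≠ 0 → g (u, t • ξ) = t ^ k * g (u, ξ)

namespace IsFibreHomogeneous

variable {n : ℕ} {U : Set (Vec n)} {k : ℕ} {g : Vec n × (Vec n →L[ℝ] ℝ) → ℝ}

theorem hasFDerivAt (hg : IsFibreHomogeneous U k g) (hU : IsOpen U) {u : Vec n} (hu : u ∈ U)
    (ξ : Vec n →L[ℝ] ℝ) : HasFDerivAt g (fderiv ℝ g (u, ξ)) (u, ξ) :=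
  ((hg.contDiffOn.contDiffAt ((hU.prod isOpen_univ).mem_nhds ⟨hu, Set.mem_univ _⟩)).differentiableAt
    (by simp)).hasFDerivAt

theorem hasDerivAt_line (hg : IsFibreHomogeneous U k g) (hU : IsOpen U) {u : Vec n} (hu : u ∈ U)
    (ξ η : Vec n →L[ℝ] ℝ) :
    HasDerivAt (fun t : ℝ => g (u, ξ + t • η)) (fderiv ℝ g (u, ξ) (0, η)) 0 := by
  have hline : HasDerivAt (fun t : ℝ => ((u, ξ + t • η) : Vec n × (Vec n →L[ℝ] ℝ))) (0, η) 0 := by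
    refine (hasDerivAt_const _ _).prodMk ?_
    simpa using ((hasDerivAt_id (0 : ℝ)).smul_const η).const_add ξ
  exact HasFDerivAt.comp_hasDerivAt_of_eq (0 : ℝ) (hg.hasFDerivAt hU hu ξ) hline (by simp)

theorem partial_smul (hg : IsFibreHomogeneous U (k + 1) g) (hU : IsOpen U) {u : Vec n} (hu : u ∈ U)
    (ξ η : Vec n →L[ℝ] ℝ) {t : ℝ} (ht : t ≠ 0) :
    fderiv ℝ g (u, t • ξ) (0, η) = t ^ k * fderiv ℝ g (u, ξ) (0, η) := by
  have h1 := hg.hasDerivAt_line hU hu (t • ξ) (t • η)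
  have h2 := (hg.hasDerivAt_line hU hu ξ η).const_mul (t ^ (k + 1))
  have h3 : (fun s : ℝ => g (u, t • ξ + s • t • η)) =
      fun s => t ^ (k + 1) * g (u, ξ + s • η) := funext fun s => by
    rw [← hg.map_smul u hu _ t ht, smul_add, smul_comm]
  rw [h3] at h1
  have h4 := h1.unique h2
  have h5 : ((0, t • η) : Vec n × (Vec n →L[ℝ] ℝ)) = t • (0, η) := by simp
  rw [h5, _root_.map_smul, smul_eq_mul, pow_succ', mul_assoc] at h4
  exact mul_left_cancel₀ ht h4

theorem partial_isFibreHomogeneous (hg : IsFibreHomogeneous U (k + 1) g) (hU : IsOpen U)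
    (η : Vec n →L[ℝ] ℝ) : IsFibreHomogeneous U k fun z => fderiv ℝ g z (0, η) where
  contDiffOn := (hg.contDiffOn.fderiv_of_isOpen (hU.prod isOpen_univ) (by simp)).clm_apply
    contDiffOn_const
  map_smul _ hu ξ _ ht := hg.partial_smul hU hu ξ η ht

/-- Euler's identity. -/
theorem euler (hg : IsFibreHomogeneous U (k + 1) g) (hU : IsOpen U) {u : Vec n} (hu : u ∈ U)
    (ξ : Vec n →L[ℝ] ℝ) :
    ∑ i, ξ (EuclideanSpace.single i 1) * fderiv ℝ g (u, ξ) (0, EuclideanSpace.proj i) =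
      (k + 1) * g (u, ξ) := by
  have h1 := hg.hasDerivAt_line hU hu ξ ξ
  have h2 : HasDerivAt (fun s : ℝ => (1 + s) ^ (k + 1) * g (u, ξ)) ((k + 1) * g (u, ξ)) 0 := by
    have := (((hasDerivAt_id (0 : ℝ)).const_add 1).pow (k + 1)).mul_const (g (u, ξ))
    simpa using this
  have h3 : (fun s : ℝ => (1 + s) ^ (k + 1) * g (u, ξ)) =ᶠ[𝓝 0]
      fun s : ℝ => g (u, ξ + s • ξ) := by
    filter_upwards [isOpen_ne.mem_nhds (show (0 : ℝ) ≠ -1 by norm_num)] with s hs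
    have hs' : 1 + s ≠ 0 := fun h => hs (by linarith)
    rw [← hg.map_smul u hu ξ _ hs', add_smul, one_smul]
  have h4 := h1.unique (h2.congr_of_eventuallyEq h3.symm)
  rw [← h4]
  have h5 : ((0, ξ) : Vec n × (Vec n →L[ℝ] ℝ)) =
      ∑ i, ξ (EuclideanSpace.single i 1) • (0, EuclideanSpace.proj i) := by
    refine Prod.ext ?_ ?_
    · rw [Prod.fst_sum]
      simp
    · rw [Prod.snd_sum]
      exact clm_eq_sum ξ
  conv_rhs => rw [h5, map_sum]
  exact Finset.sum_congr rfl fun i _ => by rw [_root_.map_smul, smul_eq_mul]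

/-- A smooth function that is homogeneous of degree `0` is constant, by continuity at `ξ = 0`. -/
theorem eq_zero_covector (hg : IsFibreHomogeneous U 0 g) (hU : IsOpen U) {u : Vec n} (hu : u ∈ U)
    (ξ : Vec n →L[ℝ] ℝ) : g (u, ξ) = g (u, 0) := by
  have h1 := (hg.hasDerivAt_line hU hu 0 ξ).continuousAt.tendsto
  simp only [zero_add, zero_smul] at h1
  refine tendsto_nhds_unique (f := fun t : ℝ => g (u, t • ξ)) (l := 𝓝[≠] (0 : ℝ)) ?_
    (h1.mono_left nhdsWithin_le_nhds)
  refine tendsto_const_nhds.congr' ?_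
  filter_upwards [self_mem_nhdsWithin] with t ht
  rw [hg.map_smul u hu ξ t ht, pow_zero, one_mul]

end IsFibreHomogeneous

/-! ### Gluing operators -/

section Gluing

variable {n : ℕ} {M : Type*} [TopologicalSpace M] [ChartedSpace (Vec n) M]

/-- The function `∑ i, ρ_i (Δ_i f)`, for a partition of unity `ρ`. The sum is locally finite. -/
noncomputable def glueFun (ρ : SmoothPartitionOfUnity M (𝓡 n) M Set.univ)
    (Δ : M → Op ℝ (SmoothFun n M)) (f : SmoothFun n M) : SmoothFun n M :=
  ⟨fun q => ∑ᶠ i, ρ i q • Δ i f q,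
    ρ.contMDiff_finsum_smul fun i _ _ => (Δ i f).contMDiff.contMDiffAt⟩

theorem glueFun_apply (ρ : SmoothPartitionOfUnity M (𝓡 n) M Set.univ)
    (Δ : M → Op ℝ (SmoothFun n M)) (f : SmoothFun n M) (q : M) :
    glueFun ρ Δ f q = ∑ i ∈ ρ.finsupport q, ρ i q * Δ i f q :=
  (ρ.sum_finsupport_smul_eq_finsum q fun i q => Δ i f q).symm

/-- The operator `∑ i, ρ_i Δ_i`, for a partition of unity `ρ`. -/
noncomputable def glue (ρ : SmoothPartitionOfUnity M (𝓡 n) M Set.univ)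
    (Δ : M → Op ℝ (SmoothFun n M)) : Op ℝ (SmoothFun n M) :=
  show SmoothFun n M →ₗ[ℝ] SmoothFun n M from
  { toFun := glueFun ρ Δ
    map_add' := fun f g => ContMDiffMap.ext fun q => by
      change glueFun ρ Δ (f + g) q = glueFun ρ Δ f q + glueFun ρ Δ g q
      rw [glueFun_apply, glueFun_apply, glueFun_apply, ← Finset.sum_add_distrib]
      exact Finset.sum_congr rfl fun i _ => (congrArg (fun a : SmoothFun n M => ρ i q * a q)
        (LinearMap.map_add (show SmoothFun n M →ₗ[ℝ] SmoothFun n M from Δ i) f g)).trans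
          (mul_add _ _ _)
    map_smul' := fun c f => ContMDiffMap.ext fun q => by
      change glueFun ρ Δ (c • f) q = c * glueFun ρ Δ f q
      rw [glueFun_apply, glueFun_apply, Finset.mul_sum]
      exact Finset.sum_congr rfl fun i _ => (congrArg (fun a : SmoothFun n M => ρ i q * a q)
        (LinearMap.map_smul (show SmoothFun n M →ₗ[ℝ] SmoothFun n M from Δ i) c f)).trans
          (mul_left_comm _ _ _) }

theorem glue_apply (ρ : SmoothPartitionOfUnity M (𝓡 n) M Set.univ)
    (Δ : M → Op ℝ (SmoothFun n M)) (f : SmoothFun n M) (q : M) :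
    glue ρ Δ f q = ∑ i ∈ ρ.finsupport q, ρ i q * Δ i f q :=
  glueFun_apply ρ Δ f q

theorem delta_glue (ρ : SmoothPartitionOfUnity M (𝓡 n) M Set.univ)
    (Δ : M → Op ℝ (SmoothFun n M)) (a : SmoothFun n M) :
    delta ℝ a (glue ρ Δ) = glue ρ fun i => delta ℝ a (Δ i) := by
  refine Op.ext fun u => ContMDiffMap.ext fun q => ?_
  change glue ρ Δ (a * u) q - a q * glue ρ Δ u q = _
  simp only [glue_apply]
  rw [Finset.mul_sum, ← Finset.sum_sub_distrib]
  refine Finset.sum_congr rfl fun i _ => ?_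
  change _ = ρ i q * (Δ i (a * u) q - a q * Δ i u q)
  ring

theorem glue_zero (ρ : SmoothPartitionOfUnity M (𝓡 n) M Set.univ) :
    glue ρ (fun _ => 0) = 0 :=
  Op.ext fun u => ContMDiffMap.ext fun q => by
    rw [glue_apply]
    exact Finset.sum_eq_zero fun i _ => mul_zero _

theorem glue_mem_diffLT (ρ : SmoothPartitionOfUnity M (𝓡 n) M Set.univ) {m : ℕ}
    {Δ : M → Op ℝ (SmoothFun n M)} (h : ∀ i, Δ i ∈ diffLT ℝ (SmoothFun n M) m) :
    glue ρ Δ ∈ diffLT ℝ (SmoothFun n M) m := by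
  induction m generalizing Δ with
  | zero =>
    have : Δ = fun _ => 0 := funext fun i => mem_diffLT_zero.1 (h i)
    rw [this, glue_zero]
    exact zero_mem _
  | succ m ih =>
    refine mem_diffLT_succ.2 fun a => ?_
    rw [delta_glue]
    exact ih fun i => mem_diffLT_succ.1 (h i) a

theorem delta_pow_glue (ρ : SmoothPartitionOfUnity M (𝓡 n) M Set.univ)
    (Δ : M → Op ℝ (SmoothFun n M)) (f : SmoothFun n M) (k : ℕ) :
    (delta ℝ f ^ k) (glue ρ Δ) = glue ρ fun i => (delta ℝ f ^ k) (Δ i) := by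
  induction k with
  | zero => rfl
  | succ k ih =>
    rw [pow_succ', Module.End.mul_apply, ih, delta_glue]
    rfl

theorem symb_glue (ρ : SmoothPartitionOfUnity M (𝓡 n) M Set.univ)
    (Δ : M → Op ℝ (SmoothFun n M)) (f : SmoothFun n M) (k : ℕ) (q : M) :
    symb k f (glue ρ Δ) q = ∑ i ∈ ρ.finsupport q, ρ i q * symb k f (Δ i) q := by
  rw [symb, dpow, delta_pow_glue]
  change (k.factorial : ℝ)⁻¹ * glue ρ _ 1 q = _
  rw [glue_apply, Finset.mul_sum]
  exact Finset.sum_congr rfl fun i _ => mul_left_comm _ _ _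

end Gluing

/-! ### Operators with a given symbol -/

section Leibniz

variable {K A : Type*} [Field K] [CommRing A] [Algebra K A]

theorem delta_of_leibniz {D : Op K A} (hD : ∀ a b, D (a * b) = D a * b + a * D b) (a : A) :
    delta K a D = Op.mulBy K (D a) := Op.ext fun u => by
  rw [delta_apply, Op.sub_apply, Op.mul_apply, Op.mul_apply, Op.mulBy_apply, Op.mulBy_apply,
    Op.mulBy_apply, hD, add_sub_cancel_right]

theorem mem_diff_one_of_leibniz {D : Op K A} (hD : ∀ a b, D (a * b) = D a * b + a * D b) :
    D ∈ Diff K A 1 :=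
  mem_diffLT_succ.2 fun a => by
    rw [delta_of_leibniz hD]
    exact mulBy_mem_diff_zero _

theorem symb_one_of_leibniz {D : Op K A} (hD : ∀ a b, D (a * b) = D a * b + a * D b) (f : A) :
    symb 1 f D = D f := by
  rw [symb, dpow, pow_one, delta_of_leibniz hD, Nat.factorial_one, Nat.cast_one, inv_one, one_smul,
    Op.mulBy_apply, mul_one]

end Leibniz

variable {n : ℕ} {M : Type*} [TopologicalSpace M] [ChartedSpace (Vec n) M] [IsManifold (𝓡 n) ∞ M]

theorem fderiv_comp_symm_mul (q₀ : M) (f a : SmoothFun n M) {u : Vec n}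
    (hu : u ∈ (extChartAt (𝓡 n) q₀).target) (v : Vec n) :
    fderiv ℝ ((f * a : SmoothFun n M) ∘ (extChartAt (𝓡 n) q₀).symm) u v =
      fderiv ℝ (f ∘ (extChartAt (𝓡 n) q₀).symm) u v * a ((extChartAt (𝓡 n) q₀).symm u) +
        f ((extChartAt (𝓡 n) q₀).symm u) * fderiv ℝ (a ∘ (extChartAt (𝓡 n) q₀).symm) u v := by
  change fderiv ℝ ((f ∘ (extChartAt (𝓡 n) q₀).symm) * (a ∘ (extChartAt (𝓡 n) q₀).symm)) u v = _
  rw [fderiv_mul (differentiableAt_comp_symm q₀ f hu) (differentiableAt_comp_symm q₀ a hu)]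
  change f _ * fderiv ℝ (a ∘ (extChartAt (𝓡 n) q₀).symm) u v +
    a _ * fderiv ℝ (f ∘ (extChartAt (𝓡 n) q₀).symm) u v = _
  ring

theorem apply_smul_of_mem_fibrePoly {k : ℕ} {F : CotangentFun n M} (hF : F ∈ fibrePoly n M k)
    (q : M) (t : ℝ) (p : TangentSpace (𝓡 n) q →L[ℝ] ℝ) : F ⟨q, t • p⟩ = t ^ k * F ⟨q, p⟩ := by
  obtain ⟨B, hB⟩ := hF q
  rw [hB, hB]
  simpa using B.map_smul_univ (fun _ => t) fun _ => p

theorem isFibreHomogeneous_of_mem_fibrePoly {k : ℕ} {F : CotangentFun n M}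
    (hF : F ∈ fibrePoly n M k) (x : CotangentBundle n M) :
    IsFibreHomogeneous (extChartAt (𝓡 n) x.1).target k
      (F ∘ (extChartAt (cotangentModel n) x).symm) where
  contDiffOn := by
    rw [← extChartAt_cotangent_target]
    exact contDiffOn_comp_extChartAt_cotangent_symm x F.contMDiff
  map_smul u hu ξ t _ := by
    have ht : (u, ξ) ∈ (extChartAt (cotangentModel n) x).target := by
      rw [extChartAt_cotangent_target]
      exact ⟨hu, Set.mem_univ _⟩
    obtain ⟨q, p, hqp⟩ : ∃ (q : M) (p : TangentSpace (𝓡 n) q →L[ℝ] ℝ),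
        (extChartAt (cotangentModel n) x).symm (u, ξ) = ⟨q, p⟩ := ⟨_, _, rfl⟩
    have h1 := (extChartAt (cotangentModel n) x).right_inv ht
    have h2 := (extChartAt (cotangentModel n) x).map_target ht
    rw [hqp] at h1 h2
    have h3 : (extChartAt (cotangentModel n) x).symm (u, t • ξ) = ⟨q, t • p⟩ := by
      have := extChartAt_cotangent_smul x t q p
      rw [h1] at this
      rw [← this]
      refine (extChartAt (cotangentModel n) x).left_inv ?_
      rw [extChartAt_cotangent_source] at h2 ⊢
      exact h2
    rw [Function.comp_apply, Function.comp_apply, h3, hqp, apply_smul_of_mem_fibrePoly hF]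

variable [T2Space M]

/-- The vector field on `M` which is the constant field `v` in the chart at `q₀`, multiplied by a
cutoff function around `q₀`; as an operator on functions. -/
noncomputable def chartField (q₀ : M) (v : Vec n) : Op ℝ (SmoothFun n M) :=
  show SmoothFun n M →ₗ[ℝ] SmoothFun n M from
  { toFun := fun f => cut q₀
      (fun q => fderiv ℝ (f ∘ (extChartAt (𝓡 n) q₀).symm) (extChartAt (𝓡 n) q₀ q) v)
      ((ContinuousLinearMap.apply ℝ ℝ v).contMDiff.comp_contMDiffOn
        (contMDiffOn_fderiv_extChartAt q₀ f))
    map_add' := fun f g => ContMDiffMap.ext fun q => by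
      change cutoff n q₀ q * _ = cutoff n q₀ q * _ + cutoff n q₀ q * _
      rw [← mul_add]
      rcases cutoff_eq_zero_or_mem (n := n) q₀ q with h | h
      · rw [h, zero_mul, zero_mul]
      · exact congrArg (fun L : Vec n →L[ℝ] ℝ => cutoff n q₀ q * L v)
          (fderiv_comp_symm_add q₀ f g h)
    map_smul' := fun c f => ContMDiffMap.ext fun q => by
      change cutoff n q₀ q * _ = c * (cutoff n q₀ q * _)
      rcases cutoff_eq_zero_or_mem (n := n) q₀ q with h | h
      · rw [h, zero_mul, zero_mul, mul_zero]
      · exact (congrArg (fun L : Vec n →L[ℝ] ℝ => cutoff n q₀ q * L v)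
          (fderiv_comp_symm_smul q₀ c f h)).trans (mul_left_comm _ _ _) }

theorem chartField_apply (q₀ : M) (v : Vec n) (f : SmoothFun n M) (q : M) :
    chartField q₀ v f q = cutoff n q₀ q *
      fderiv ℝ (f ∘ (extChartAt (𝓡 n) q₀).symm) (extChartAt (𝓡 n) q₀ q) v := rfl

theorem chartField_mul (q₀ : M) (v : Vec n) (a b : SmoothFun n M) :
    chartField q₀ v (a * b) = chartField q₀ v a * b + a * chartField q₀ v b := by
  refine ContMDiffMap.ext fun q => ?_
  change chartField q₀ v (a * b) q = chartField q₀ v a q * b q + a q * chartField q₀ v b q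
  simp only [chartField_apply]
  by_cases hq : q ∈ (extChartAt (𝓡 n) q₀).source
  · rw [fderiv_comp_symm_mul q₀ a b ((extChartAt (𝓡 n) q₀).map_source hq),
      (extChartAt (𝓡 n) q₀).left_inv hq]
    ring
  · have h0 : cutoff n q₀ q = 0 := by
      rw [extChartAt_source] at hq
      exact Function.notMem_support.1 fun h => hq ((cutoff n q₀).support_subset_source h)
    rw [h0, zero_mul, zero_mul, zero_mul, zero_mul, mul_zero, add_zero]

/-- Near `q₀`, every homogeneous function is the symbol of an operator: `∂g/∂ξ_i` is one by
induction on the degree, and by Euler's identity so is `g`. -/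
theorem exists_local_operator (q₀ : M) {k : ℕ} {g : Vec n × (Vec n →L[ℝ] ℝ) → ℝ}
    (hg : IsFibreHomogeneous (extChartAt (𝓡 n) q₀).target k g) :
    ∃ Δ ∈ Diff ℝ (SmoothFun n M) k, ∀ q ∈ (chartAt (Vec n) q₀).source, cutoff n q₀ q = 1 →
      ∀ f : SmoothFun n M, symb k f Δ q = g (extChartAt (𝓡 n) q₀ q,
        fderiv ℝ (f ∘ (extChartAt (𝓡 n) q₀).symm) (extChartAt (𝓡 n) q₀ q)) := by
  have hU := isOpen_extChartAt_target (I := 𝓡 n) q₀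
  have hmaps : ∀ q ∈ (chartAt (Vec n) q₀).source,
      extChartAt (𝓡 n) q₀ q ∈ (extChartAt (𝓡 n) q₀).target := fun q hq =>
    (extChartAt (𝓡 n) q₀).map_source (by rwa [extChartAt_source])
  induction k generalizing g with
  | zero =>
    have h0 : ContDiffOn ℝ ∞ (fun u => g (u, 0)) (extChartAt (𝓡 n) q₀).target :=
      hg.contDiffOn.comp (contDiff_prodMk_left 0).contDiffOn fun u hu => ⟨hu, Set.mem_univ _⟩
    refine ⟨Op.mulBy ℝ (cut q₀ (fun q => g (extChartAt (𝓡 n) q₀ q, 0))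
      (h0.contMDiffOn.comp contMDiffOn_extChartAt hmaps)), mulBy_mem_diff_zero _,
      fun q hq h1 f => ?_⟩
    rw [symb_zero_mulBy, cut_apply_of_eq_one _ h1, ← hg.eq_zero_covector hU (hmaps q hq)]
  | succ k ih =>
    choose Δ hΔ hs using fun i : Fin n =>
      ih (hg.partial_isFibreHomogeneous hU (EuclideanSpace.proj i))
    have hD (i : Fin n) : chartField q₀ (EuclideanSpace.single i 1) ∈ Diff ℝ (SmoothFun n M) 1 :=
      mem_diff_one_of_leibniz (chartField_mul q₀ _)
    have hmem (i : Fin n) : chartField q₀ (EuclideanSpace.single i 1) * Δ i ∈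
        Diff ℝ (SmoothFun n M) (k + 1) := add_comm 1 k ▸ mul_mem_diff (hD i) (hΔ i)
    refine ⟨(k + 1 : ℝ)⁻¹ • ∑ i, chartField q₀ (EuclideanSpace.single i 1) * Δ i,
      Submodule.smul_mem _ _ (sum_mem fun i _ => hmem i), fun q hq h1 f => ?_⟩
    let ev : Op ℝ (SmoothFun n M) →+ ℝ :=
      { toFun := fun φ => symb (k + 1) f φ q
        map_zero' := congrArg (fun a : SmoothFun n M => a q) (symb_eq_zero f (zero_mem _))
        map_add' := fun φ ψ => congrArg (fun a : SmoothFun n M => a q) (symb_add (k + 1) f φ ψ) }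
    have hsum : symb (k + 1) f (∑ i, chartField q₀ (EuclideanSpace.single i 1) * Δ i) q =
        ∑ i, symb (k + 1) f (chartField q₀ (EuclideanSpace.single i 1) * Δ i) q := map_sum ev _ _
    rw [symb_smul]
    change (k + 1 : ℝ)⁻¹ * symb (k + 1) f _ q = _
    rw [hsum, inv_mul_eq_iff_eq_mul₀ (by positivity), ← hg.euler hU (hmaps q hq)]
    refine Finset.sum_congr rfl fun i _ => ?_
    rw [add_comm k 1, symb_mul f (hD i) (hΔ i), symb_one_of_leibniz (chartField_mul q₀ _)]
    change chartField q₀ _ f q * symb k f (Δ i) q = _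
    rw [hs i q hq h1 f, chartField_apply, h1, one_mul]

/-- Exactness on the right: operators with the given symbol near each point are glued by a partition
of unity. -/
theorem symbolMap_surjective [SecondCountableTopology M] (k : ℕ) :
    Function.Surjective (symbolMap n M k) := by
  rintro ⟨F, hF⟩
  choose Δ hΔ hs using fun q₀ : M => exists_local_operator q₀
    (isFibreHomogeneous_of_mem_fibrePoly hF (⟨q₀, 0⟩ : CotangentBundle n M))
  have : LocallyCompactSpace M := ChartedSpace.locallyCompactSpace (Vec n) M
  obtain ⟨ρ, hρ⟩ := SmoothPartitionOfUnity.exists_isSubordinate (𝓡 n) (s := (Set.univ : Set M))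
    isClosed_univ (fun q₀ => interior {q | q ∈ (chartAt (Vec n) q₀).source ∧ cutoff n q₀ q = 1})
    (fun _ => isOpen_interior) fun q₀ _ => Set.mem_iUnion.2 ⟨q₀, mem_interior_iff_mem_nhds.2 (by
      filter_upwards [eventually_cutoff_eq_one (n := n) q₀] with q hq
      exact ⟨hq.1, hq.2.self_of_nhds⟩)⟩
  refine ⟨⟨glue ρ Δ, glue_mem_diffLT ρ hΔ⟩, Subtype.ext (cotangentFun_ext fun f q => ?_)⟩
  rw [symbolMap_differential, symb_glue]
  have h1 : ∀ i ∈ ρ.finsupport q, ρ i q * symb k f (Δ i) q = ρ i q * F (differential f q) := by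
    intro i hi
    have hq := interior_subset (hρ i (subset_closure ((ρ.mem_finsupport q).1 hi)))
    rw [hs i q hq.1 hq.2 f]
    exact congrArg _
      (comp_extChartAt_cotangent_symm_differential (⟨i, 0⟩ : CotangentBundle n M) F f hq.1)
  rw [Finset.sum_congr rfl h1, ← Finset.sum_mul, ρ.sum_finsupport q (Set.mem_univ q), one_mul]

end Surjectivity


/-! ### Transport of Poisson brackets -/

section Transport

variable {K A B : Type*} [CommRing K] [CommRing A] [Algebra K A] [CommRing B] [Algebra K B]

/-- The transport of a bilinear operation along an isomorphism of algebras. -/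
def transport (e : A ≃ₐ[K] B) (b : A →ₗ[K] A →ₗ[K] A) : B →ₗ[K] B →ₗ[K] B :=
  (b.compl₁₂ e.symm.toLinearMap e.symm.toLinearMap).compr₂ e.toLinearMap

theorem transport_apply (e : A ≃ₐ[K] B) (b : A →ₗ[K] A →ₗ[K] A) (x y : B) :
    transport e b x y = e (b (e.symm x) (e.symm y)) := rfl

theorem IsPoissonBracket.transport {b : A →ₗ[K] A →ₗ[K] A} (hb : IsPoissonBracket b)
    (e : A ≃ₐ[K] B) : IsPoissonBracket (transport e b) where
  self_eq_zero x := by rw [transport_apply, hb.self_eq_zero, map_zero]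
  jacobi x y z := by
    simp only [transport_apply, AlgEquiv.symm_apply_apply]
    rw [← map_add, ← map_add, hb.jacobi, map_zero]
  leibniz x y z := by
    simp only [transport_apply, map_mul]
    rw [hb.leibniz, map_add, map_mul, map_mul, AlgEquiv.apply_symm_apply,
      AlgEquiv.apply_symm_apply]

end Transport

/-! ### The symbol algebra is a Poisson algebra -/

section SymbolPoisson

variable {K A : Type*} [CommRing K] [CommRing A] [Algebra K A]

open Classical in
/-- The class of `φ` in the component of degree `k` of the symbol algebra; the value is `0` if `φ`
is not of order `≤ k`. Being indexed by the degree and the operator alone, classes in equal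
degrees can be compared without casts. -/
noncomputable def cls (k : ℕ) (φ : Op K A) : SmblAlg K A :=
  if h : φ ∈ Diff K A k then DirectSum.of (Smbl K A) k (gr k ⟨φ, h⟩) else 0

theorem cls_of_mem {k : ℕ} {φ : Op K A} (h : φ ∈ Diff K A k) :
    cls k φ = DirectSum.of (Smbl K A) k (gr k ⟨φ, h⟩) := dif_pos h

theorem of_gr {k : ℕ} (φ : Diff K A k) :
    DirectSum.of (Smbl K A) k (gr k φ) = cls k φ.1 := (cls_of_mem φ.2).symm

theorem cls_eq_zero {k : ℕ} {φ : Op K A} (h : φ ∈ diffLT K A k) : cls k φ = 0 := by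
  rw [cls_of_mem (diffLT_le_succ k h), gr_eq_zero h, map_zero]

theorem cls_add {k : ℕ} {φ ψ : Op K A} (hφ : φ ∈ Diff K A k) (hψ : ψ ∈ Diff K A k) :
    cls k (φ + ψ) = cls k φ + cls k ψ := by
  rw [cls_of_mem hφ, cls_of_mem hψ, cls_of_mem (add_mem hφ hψ), ← map_add]
  rfl

theorem cls_mul {k l : ℕ} {φ ψ : Op K A} (hφ : φ ∈ Diff K A k) (hψ : ψ ∈ Diff K A l) :
    cls k φ * cls l ψ = cls (k + l) (φ * ψ) := by
  rw [cls_of_mem hφ, cls_of_mem hψ, of_mul_of, of_gr]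

theorem smblBracket_cls {k l : ℕ} {φ ψ : Op K A} (hφ : φ ∈ Diff K A k) (hψ : ψ ∈ Diff K A l) :
    smblBracket K A (cls k φ) (cls l ψ) = cls (k + l - 1) (φ * ψ - ψ * φ) := by
  rw [cls_of_mem hφ, cls_of_mem hψ, smblBracket_of, of_gr]

theorem smblAlg_induction {p : SmblAlg K A → Prop} (h0 : p 0)
    (hadd : ∀ x y, p x → p y → p (x + y))
    (hcls : ∀ k, ∀ φ ∈ Diff K A k, p (cls k φ)) (x : SmblAlg K A) : p x := by
  induction x using DirectSum.induction_on with
  | zero => exact h0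
  | of k x =>
    obtain ⟨φ, rfl⟩ := gr_surj x
    rw [of_gr]
    exact hcls k _ φ.2
  | add x y hx hy => exact hadd x y hx hy

theorem commutator_eq_zero {φ ψ : Op K A} (hφ : φ ∈ Diff K A 0) (hψ : ψ ∈ Diff K A 0) :
    φ * ψ - ψ * φ = 0 :=
  mem_diffLT_zero.1 (commutator_mem_diffLT 1 1 hφ hψ)

theorem smblBracket_skew (x y : SmblAlg K A) : smblBracket K A x y = -smblBracket K A y x := by
  induction x using smblAlg_induction with
  | h0 => rw [LinearMap.map_zero₂, map_zero, neg_zero]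
  | hadd x x' hx hx' => rw [LinearMap.map_add₂, map_add, hx, hx', neg_add]
  | hcls k φ hφ =>
    induction y using smblAlg_induction with
    | h0 => rw [LinearMap.map_zero₂, map_zero, neg_zero]
    | hadd y y' hy hy' => rw [LinearMap.map_add₂, map_add, hy, hy', neg_add]
    | hcls l ψ hψ =>
      rw [smblBracket_cls hφ hψ, smblBracket_cls hψ hφ, add_comm l k, eq_neg_iff_add_eq_zero,
        ← cls_add (commutator_mem_diff hφ hψ) (add_comm k l ▸ commutator_mem_diff hψ hφ),
        sub_add_sub_cancel, sub_self]
      exact cls_eq_zero (zero_mem _)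

theorem smblBracket_self (x : SmblAlg K A) : smblBracket K A x x = 0 := by
  induction x using smblAlg_induction with
  | h0 => rw [map_zero]
  | hadd x y hx hy =>
    rw [map_add, LinearMap.map_add₂, LinearMap.map_add₂, hx, hy, smblBracket_skew y x]
    abel
  | hcls k φ hφ =>
    rw [smblBracket_cls hφ hφ, sub_self]
    exact cls_eq_zero (zero_mem _)

/-- On classes of operators this is `[φψ, χ] = φ[ψ, χ] + [φ, χ]ψ`. If two of the degrees are zero,
the degrees of the two sides may differ because `0 - 1 = 0`, but then the commutator is zero. -/
theorem smblBracket_leibniz (x y z : SmblAlg K A) : smblBracket K A (x * y) z =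
    x * smblBracket K A y z + smblBracket K A x z * y := by
  induction x using smblAlg_induction with
  | h0 => simp only [zero_mul, LinearMap.map_zero₂, add_zero]
  | hadd x x' hx hx' =>
    simp only [add_mul, LinearMap.map_add₂, hx, hx']
    abel
  | hcls k φ hφ =>
    induction y using smblAlg_induction with
    | h0 => simp only [mul_zero, LinearMap.map_zero₂, add_zero]
    | hadd y y' hy hy' =>
      simp only [mul_add, LinearMap.map_add₂, hy, hy']
      abel
    | hcls l ψ hψ =>
      induction z using smblAlg_induction with
      | h0 => simp only [map_zero, mul_zero, zero_mul, add_zero]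
      | hadd z z' hz hz' =>
        simp only [mul_add, add_mul, map_add, hz, hz']
        abel
      | hcls m χ hχ =>
        have hA : φ * (ψ * χ - χ * ψ) ∈ Diff K A (k + l + m - 1) ∧
            cls k φ * cls (l + m - 1) (ψ * χ - χ * ψ) =
              cls (k + l + m - 1) (φ * (ψ * χ - χ * ψ)) := by
          rcases Nat.eq_zero_or_pos (l + m) with h | h
          · obtain ⟨rfl, rfl⟩ : l = 0 ∧ m = 0 := by omega
            rw [commutator_eq_zero hψ hχ, mul_zero, cls_eq_zero (zero_mem _),
              cls_eq_zero (zero_mem _), mul_zero]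
            exact ⟨zero_mem _, rfl⟩
          · have e : k + (l + m - 1) = k + l + m - 1 := by omega
            rw [cls_mul hφ (commutator_mem_diff hψ hχ), e]
            exact ⟨e ▸ mul_mem_diff hφ (commutator_mem_diff hψ hχ), rfl⟩
        have hB : (φ * χ - χ * φ) * ψ ∈ Diff K A (k + l + m - 1) ∧
            cls (k + m - 1) (φ * χ - χ * φ) * cls l ψ =
              cls (k + l + m - 1) ((φ * χ - χ * φ) * ψ) := by
          rcases Nat.eq_zero_or_pos (k + m) with h | h
          · obtain ⟨rfl, rfl⟩ : k = 0 ∧ m = 0 := by omega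
            rw [commutator_eq_zero hφ hχ, zero_mul, cls_eq_zero (zero_mem _),
              cls_eq_zero (zero_mem _), zero_mul]
            exact ⟨zero_mem _, rfl⟩
          · have e : k + m - 1 + l = k + l + m - 1 := by omega
            rw [cls_mul (commutator_mem_diff hφ hχ) hψ, e]
            exact ⟨e ▸ mul_mem_diff (commutator_mem_diff hφ hχ) hψ, rfl⟩
        rw [cls_mul hφ hψ, smblBracket_cls (mul_mem_diff hφ hψ) hχ, smblBracket_cls hψ hχ,
          smblBracket_cls hφ hχ, hA.2, hB.2, ← cls_add hA.1 hB.1]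
        congr 1
        noncomm_ring

/-- The double bracket, with the degree written symmetrically in the three arguments. The degrees
`k + (l + m - 1) - 1` and `k + l + m - 2` differ only if `l = m = 0`, where `[ψ, χ] = 0`. -/
theorem smblBracket_smblBracket_cls {k l m : ℕ} {φ ψ χ : Op K A} (hφ : φ ∈ Diff K A k)
    (hψ : ψ ∈ Diff K A l) (hχ : χ ∈ Diff K A m) :
    φ * (ψ * χ - χ * ψ) - (ψ * χ - χ * ψ) * φ ∈ Diff K A (k + l + m - 2) ∧
      smblBracket K A (cls k φ) (smblBracket K A (cls l ψ) (cls m χ)) =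
        cls (k + l + m - 2) (φ * (ψ * χ - χ * ψ) - (ψ * χ - χ * ψ) * φ) := by
  have h1 := commutator_mem_diff hψ hχ
  have h2 := commutator_mem_diff hφ h1
  rw [smblBracket_cls hψ hχ, smblBracket_cls hφ h1]
  rcases Nat.eq_zero_or_pos (l + m) with h | h
  · obtain ⟨rfl, rfl⟩ : l = 0 ∧ m = 0 := by omega
    rw [commutator_eq_zero hψ hχ, mul_zero, zero_mul, sub_zero, cls_eq_zero (zero_mem _),
      cls_eq_zero (zero_mem _)]
    exact ⟨zero_mem _, rfl⟩
  · have e : k + (l + m - 1) - 1 = k + l + m - 2 := by omega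
    rw [e] at h2 ⊢
    exact ⟨h2, rfl⟩

theorem smblBracket_jacobi (x y z : SmblAlg K A) :
    smblBracket K A x (smblBracket K A y z) + smblBracket K A y (smblBracket K A z x) +
      smblBracket K A z (smblBracket K A x y) = 0 := by
  induction x using smblAlg_induction with
  | h0 => simp only [map_zero, LinearMap.zero_apply, add_zero]
  | hadd x x' hx hx' =>
    simp only [map_add, LinearMap.add_apply]
    rw [← add_zero (0 : SmblAlg K A)]
    nth_rewrite 1 [← hx]
    rw [← hx']
    abel
  | hcls k φ hφ =>
    induction y using smblAlg_induction with
    | h0 => simp only [map_zero, LinearMap.zero_apply, add_zero]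
    | hadd y y' hy hy' =>
      simp only [map_add, LinearMap.add_apply]
      rw [← add_zero (0 : SmblAlg K A)]
      nth_rewrite 1 [← hy]
      rw [← hy']
      abel
    | hcls l ψ hψ =>
      induction z using smblAlg_induction with
      | h0 => simp only [map_zero, LinearMap.zero_apply, add_zero]
      | hadd z z' hz hz' =>
        simp only [map_add, LinearMap.add_apply]
        rw [← add_zero (0 : SmblAlg K A)]
        nth_rewrite 1 [← hz]
        rw [← hz']
        abel
      | hcls m χ hχ =>
        have h1 := smblBracket_smblBracket_cls hφ hψ hχ
        have h2 := smblBracket_smblBracket_cls hψ hχ hφ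
        have h3 := smblBracket_smblBracket_cls hχ hφ hψ
        rw [show l + m + k = k + l + m by omega] at h2
        rw [show m + k + l = k + l + m by omega] at h3
        rw [h1.2, h2.2, h3.2, ← cls_add h1.1 h2.1, ← cls_add (add_mem h1.1 h2.1) h3.1]
        refine cls_eq_zero ?_
        convert zero_mem (diffLT K A (k + l + m - 2)) using 1
        noncomm_ring

theorem isPoissonBracket_smblBracket : IsPoissonBracket (smblBracket K A) where
  self_eq_zero := smblBracket_self
  jacobi := smblBracket_jacobi
  leibniz := smblBracket_leibniz

end SymbolPoisson

/-! ### The isomorphism of algebras -/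

section Isomorphism

variable {n : ℕ} {M : Type*} [TopologicalSpace M] [ChartedSpace (Vec n) M] [IsManifold (𝓡 n) ∞ M]

/-- A vanishing sum of functions that are homogeneous of distinct degrees along the fibres vanishes
term by term: restrict it to the lines in the fibres. -/
theorem eq_zero_of_sum_fibrePoly_eq_zero (s : Finset ℕ) (F : ℕ → CotangentFun n M)
    (hF : ∀ k ∈ s, F k ∈ fibrePoly n M k) (hsum : ∑ k ∈ s, F k = 0) {k : ℕ} (hk : k ∈ s) :
    F k = 0 := by
  refine ContMDiffMap.ext fun ⟨q, p⟩ => ?_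
  obtain ⟨N, hN⟩ := s.exists_nat_subset_range
  classical
  have h := eq_zero_of_sum_pow_smul_eq_zero (K := ℝ) (N := N)
    (v := fun j => if j ∈ s then F j ⟨q, p⟩ else 0) (fun t => by
      have h1 := congrArg (fun G : CotangentFun n M => G ⟨q, t • p⟩) hsum
      have h2 : (∑ k ∈ s, F k : CotangentFun n M) ⟨q, t • p⟩ = ∑ k ∈ s, F k ⟨q, t • p⟩ :=
        map_sum (ContMDiffMap.evalRingHom (⟨q, t • p⟩ : CotangentBundle n M)) _ _
      have h3 : ∑ k ∈ s, F k ⟨q, t • p⟩ = 0 := h2.symm.trans h1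
      rw [← Finset.sum_subset hN fun j _ hj => by rw [if_neg hj, smul_zero]]
      refine Eq.trans (Finset.sum_congr rfl fun j hj => ?_) h3
      rw [if_pos hj, apply_smul_of_mem_fibrePoly (hF j hj), smul_eq_mul])
    (Finset.mem_range.1 (hN hk))
  rwa [if_pos hk] at h

theorem iSupIndep_fibrePoly : iSupIndep (fibrePoly n M) :=
  (iSupIndep_iff_finsetSum_eq_zero_imp_eq_zero _).2 fun s F hF hsum _ hk =>
    eq_zero_of_sum_fibrePoly_eq_zero s F hF hsum hk

/-- The inclusion `P_k(T*M) ⊆ P(T*M)`. -/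
def fibrePolyIncl (n : ℕ) (M : Type*) [TopologicalSpace M] [ChartedSpace (Vec n) M]
    [IsManifold (𝓡 n) ∞ M] (k : ℕ) : fibrePoly n M k →ₗ[ℝ] fibrePolyAlg n M where
  toFun F := ⟨F.1, Submodule.mem_iSup_of_mem k F.2⟩
  map_add' _ _ := rfl
  map_smul' _ _ := rfl

variable [T2Space M]

/-- The map `Smbl_k(M) → P(T*M)` induced by the symbol map `σ_k`. -/
noncomputable def smblMap (n : ℕ) (M : Type*) [TopologicalSpace M] [ChartedSpace (Vec n) M]
    [IsManifold (𝓡 n) ∞ M] [T2Space M] (k : ℕ) :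
    Smbl ℝ (SmoothFun n M) k →ₗ[ℝ] fibrePolyAlg n M :=
  (fibrePolyIncl n M k).comp (Submodule.liftQ _ (symbolMap n M k)
    fun Δ hΔ => (symbolMap_eq_zero_iff Δ).2 hΔ)

theorem smblMap_gr {k : ℕ} (Δ : Diff ℝ (SmoothFun n M) k) :
    (smblMap n M k (gr k Δ)).1 = (symbolMap n M k Δ).1 := rfl

theorem smblMap_eq_zero {k : ℕ} {x : Smbl ℝ (SmoothFun n M) k} (hx : smblMap n M k x = 0) :
    x = 0 := by
  obtain ⟨Δ, rfl⟩ := gr_surj x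
  have h : (symbolMap n M k Δ).1 = 0 := congrArg (fun F : fibrePolyAlg n M => F.1) hx
  exact gr_eq_zero ((symbolMap_eq_zero_iff Δ).1 (Subtype.ext h))

/-- The homomorphism `Smbl(M) → P(T*M)` induced by the symbol maps. -/
noncomputable def smblHom (n : ℕ) (M : Type*) [TopologicalSpace M] [ChartedSpace (Vec n) M]
    [IsManifold (𝓡 n) ∞ M] [T2Space M] : SmblAlg ℝ (SmoothFun n M) →ₐ[ℝ] fibrePolyAlg n M :=
  DirectSum.toAlgebra ℝ _ (smblMap n M)
    (Subtype.ext (cotangentFun_ext fun f q => by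
      change (symbolMap n M 0 ⟨1, one_mem_diff_zero⟩).1 (differential f q) = 1
      rw [symbolMap_differential, symb, dpow_zero]
      rfl))
    (fun {k l} x y => by
      obtain ⟨φ, rfl⟩ := gr_surj x
      obtain ⟨ψ, rfl⟩ := gr_surj y
      refine Subtype.ext (cotangentFun_ext fun f q => ?_)
      change (symbolMap n M (k + l) ⟨φ.1 * ψ.1, mul_mem_diff φ.2 ψ.2⟩).1 (differential f q) =
        (symbolMap n M k φ).1 (differential f q) * (symbolMap n M l ψ).1 (differential f q)
      simp only [symbolMap_differential]
      rw [symb_mul f φ.2 ψ.2]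
      rfl)

theorem smblHom_of {k : ℕ} (x : Smbl ℝ (SmoothFun n M) k) :
    smblHom n M (DirectSum.of (Smbl ℝ (SmoothFun n M)) k x) = smblMap n M k x :=
  DirectSum.toAddMonoid_of (fun i => (smblMap n M i).toAddMonoidHom) k x

theorem coe_smblHom_cls {k : ℕ} {φ : Op ℝ (SmoothFun n M)} (h : φ ∈ Diff ℝ (SmoothFun n M) k) :
    ((smblHom n M (cls k φ)).1 : CotangentBundle n M → ℝ) = symbFun k φ := by
  rw [cls_of_mem h, smblHom_of, smblMap_gr]
  rfl

theorem smblHom_injective : Function.Injective (smblHom n M) := by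
  classical
  refine (injective_iff_map_eq_zero _).2 fun x hx => ?_
  have h1 : smblHom n M x = ∑ k ∈ x.support, smblMap n M k (x k) := by
    conv_lhs => rw [← DirectSum.sum_support_of x, map_sum]
    exact Finset.sum_congr rfl fun k _ => smblHom_of _
  have h2 : ∑ k ∈ x.support, (smblMap n M k (x k)).1 = 0 := by
    rw [hx] at h1
    exact ((map_sum (fibrePolyAlg n M).val _ _).symm.trans (congrArg Subtype.val h1.symm))
  refine DFinsupp.ext fun k => ?_
  by_cases hk : k ∈ x.support
  · refine smblMap_eq_zero (Subtype.ext (eq_zero_of_sum_fibrePoly_eq_zero x.support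
      (fun k => (smblMap n M k (x k)).1) (fun k _ => ?_) h2 hk))
    obtain ⟨Δ, hΔ⟩ := gr_surj (x k)
    rw [← hΔ, smblMap_gr]
    exact (symbolMap n M k Δ).2
  · exact DFinsupp.notMem_support_iff.1 hk

theorem smblHom_surjective [SecondCountableTopology M] : Function.Surjective (smblHom n M) := by
  rintro ⟨F, hF⟩
  suffices h : ∃ x, (smblHom n M x).1 = F by
    obtain ⟨x, hx⟩ := h
    exact ⟨x, Subtype.ext hx⟩
  refine Submodule.iSup_induction (fibrePoly n M) (motive := fun F => ∃ x, (smblHom n M x).1 = F) hF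
    (fun k F hF => ?_) ⟨0, by rw [map_zero]; rfl⟩ ?_
  · obtain ⟨Δ, hΔ⟩ := symbolMap_surjective k ⟨F, hF⟩
    exact ⟨DirectSum.of _ k (gr k Δ), by rw [smblHom_of, smblMap_gr, hΔ]⟩
  · rintro _ _ ⟨x, rfl⟩ ⟨y, rfl⟩
    exact ⟨x + y, by rw [map_add]; rfl⟩

end Isomorphism

/-! ### Compatibility with the brackets -/

section CanonicalBracket

variable {n : ℕ} {M : Type*} [TopologicalSpace M] [ChartedSpace (Vec n) M] [IsManifold (𝓡 n) ∞ M]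

theorem canonicalBracket_skew (F G : CotangentBundle n M → ℝ) (x : CotangentBundle n M) :
    canonicalBracket F G x = -canonicalBracket G F x := by
  rw [canonicalBracket, canonicalBracket, ← Finset.sum_neg_distrib]
  exact Finset.sum_congr rfl fun i _ => by ring

theorem fderiv_comp_cotangent_symm_add (F G : CotangentFun n M) (x : CotangentBundle n M) :
    fderiv ℝ ((F + G : CotangentFun n M) ∘ (extChartAt (cotangentModel n) x).symm)
        (extChartAt (cotangentModel n) x x) =
      fderiv ℝ (F ∘ (extChartAt (cotangentModel n) x).symm) (extChartAt (cotangentModel n) x x) +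
      fderiv ℝ (G ∘ (extChartAt (cotangentModel n) x).symm) (extChartAt (cotangentModel n) x x) :=
  fderiv_add (differentiableAt_comp_extChartAt_cotangent_symm x F.contMDiff)
    (differentiableAt_comp_extChartAt_cotangent_symm x G.contMDiff)

theorem canonicalBracket_add_left (F G H : CotangentFun n M) (x : CotangentBundle n M) :
    canonicalBracket (F + G : CotangentFun n M) H x =
      canonicalBracket F H x + canonicalBracket G H x := by
  have hQ (i : Fin n) : partialQ i (F + G : CotangentFun n M) x = partialQ i F x + partialQ i G x :=
    congrArg (fun L : Vec n × (Vec n →L[ℝ] ℝ) →L[ℝ] ℝ => L (EuclideanSpace.single i 1, 0))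
      (fderiv_comp_cotangent_symm_add F G x)
  have hP (i : Fin n) : partialP i (F + G : CotangentFun n M) x = partialP i F x + partialP i G x :=
    congrArg (fun L : Vec n × (Vec n →L[ℝ] ℝ) →L[ℝ] ℝ => L (0, EuclideanSpace.proj i))
      (fderiv_comp_cotangent_symm_add F G x)
  simp only [canonicalBracket, hQ, hP]
  rw [← Finset.sum_add_distrib]
  exact Finset.sum_congr rfl fun i _ => by ring

theorem canonicalBracket_zero_left (H : CotangentFun n M) (x : CotangentBundle n M) :
    canonicalBracket (0 : CotangentFun n M) H x = 0 := by
  have := canonicalBracket_add_left 0 0 H x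
  rwa [add_zero, left_eq_add] at this

variable [T2Space M]

/-- By bilinearity it is enough to consider classes of operators, where this is
`symbFun_commutator`. -/
theorem smblHom_smblBracket (s t : SmblAlg ℝ (SmoothFun n M)) (x : CotangentBundle n M) :
    (smblHom n M (smblBracket ℝ (SmoothFun n M) s t)).1 x =
      canonicalBracket (smblHom n M s).1 (smblHom n M t).1 x := by
  have hz (H : CotangentFun n M) : canonicalBracket (0 : fibrePolyAlg n M).1 H x = 0 :=
    canonicalBracket_zero_left H x
  have ha (F G : fibrePolyAlg n M) (H : CotangentFun n M) : canonicalBracket (F + G).1 H x =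
      canonicalBracket F.1 H x + canonicalBracket G.1 H x :=
    canonicalBracket_add_left F.1 G.1 H x
  induction s using smblAlg_induction with
  | h0 =>
    rw [LinearMap.map_zero₂, map_zero, hz]
    rfl
  | hadd s s' hs hs' =>
    rw [LinearMap.map_add₂, map_add, map_add, ha, ← hs, ← hs']
    rfl
  | hcls k φ hφ =>
    induction t using smblAlg_induction with
    | h0 =>
      rw [map_zero, map_zero, canonicalBracket_skew, hz, neg_zero]
      rfl
    | hadd t t' ht ht' =>
      rw [map_add, map_add, map_add, canonicalBracket_skew, ha, neg_add, ← canonicalBracket_skew,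
        ← canonicalBracket_skew, ← ht, ← ht']
      rfl
    | hcls l ψ hψ =>
      calc
        (smblHom n M (smblBracket ℝ (SmoothFun n M) (cls k φ) (cls l ψ))).1 x =
            (smblHom n M (cls (k + l - 1) (φ * ψ - ψ * φ))).1 x :=
          congrArg (fun s => (smblHom n M s).1 x) (smblBracket_cls hφ hψ)
        _ = symbFun (k + l - 1) (φ * ψ - ψ * φ) x :=
          congrFun (coe_smblHom_cls (commutator_mem_diff hφ hψ)) x
        _ = canonicalBracket (symbFun k φ) (symbFun l ψ) x := symbFun_commutator hφ hψ x
        _ = canonicalBracket (smblHom n M (cls k φ)).1 (smblHom n M (cls l ψ)).1 x :=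
          congrArg₂ (canonicalBracket · · x) (coe_smblHom_cls hφ).symm (coe_smblHom_cls hψ).symm

end CanonicalBracket

end SymbolAlgebra

theorem mainTheorem6 (n : ℕ) (M : Type*) [TopologicalSpace M]
    [ChartedSpace (EuclideanSpace ℝ (Fin n)) M] [IsManifold (𝓡 n) ∞ M] [T2Space M]
    [SecondCountableTopology M] :
    -- the symbol algebra, with the bracket induced by the commutator, is a Poisson algebra
    IsPoissonBracket (smblBracket ℝ (SmoothFun n M)) ∧
    -- `P(T*M)` is the direct sum of the `P_k(T*M)`
    iSupIndep (fibrePoly n M) ∧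
    -- `P(T*M)` is closed under the canonical bracket, and a Poisson algebra with it
    ∃ b : fibrePolyAlg n M →ₗ[ℝ] fibrePolyAlg n M →ₗ[ℝ] fibrePolyAlg n M,
      (∀ F G x, (b F G).1 x = canonicalBracket F.1 G.1 x) ∧
      IsPoissonBracket b ∧
      -- the symbol maps exist, and give short exact sequences
      ∃ σ : ∀ k, Diff ℝ (SmoothFun n M) k →ₗ[ℝ] fibrePoly n M k,
        (∀ k Δ, IsSymbol k Δ.1 (σ k Δ).1) ∧
        (∀ k, Function.Injective (Submodule.inclusion (diffLT_le_succ (K := ℝ)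
            (A := SmoothFun n M) k)) ∧
          Function.Exact (Submodule.inclusion (diffLT_le_succ (K := ℝ)
            (A := SmoothFun n M) k)) (σ k) ∧
          Function.Surjective (σ k)) ∧
        -- they induce an isomorphism of Poisson algebras
        ∃ e : SmblAlg ℝ (SmoothFun n M) ≃ₐ[ℝ] fibrePolyAlg n M,
          (∀ k Δ, (e (DirectSum.of (Smbl ℝ (SmoothFun n M)) k (gr k Δ))).1 = (σ k Δ).1) ∧
          ∀ s t, e (smblBracket ℝ (SmoothFun n M) s t) = b (e s) (e t) := by
  let e : SmblAlg ℝ (SmoothFun n M) ≃ₐ[ℝ] fibrePolyAlg n M :=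
    AlgEquiv.ofBijective (smblHom n M) ⟨smblHom_injective, smblHom_surjective⟩
  -- The bracket on `P(T*M)` is the one transported from `Smbl(M)`; it is a Poisson bracket for
  -- formal reasons, and equal to the canonical bracket by `smblHom_smblBracket`.
  refine ⟨isPoissonBracket_smblBracket, iSupIndep_fibrePoly, transport e (smblBracket ℝ _),
    fun F G x => ?_, isPoissonBracket_smblBracket.transport e, symbolMap n M,
    fun k Δ => isSymbol_symbolMap Δ,
    fun k => ⟨Submodule.inclusion_injective _, fun Δ => ?_, symbolMap_surjective k⟩, e,
    fun k Δ => ?_, fun s t => ?_⟩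
  · obtain ⟨s, rfl⟩ := e.surjective F
    obtain ⟨t, rfl⟩ := e.surjective G
    rw [transport_apply, AlgEquiv.symm_apply_apply, AlgEquiv.symm_apply_apply]
    exact smblHom_smblBracket s t x
  · rw [symbolMap_eq_zero_iff]
    exact ⟨fun h => ⟨⟨Δ.1, h⟩, rfl⟩, by rintro ⟨Δ', rfl⟩; exact Δ'.2⟩
  · exact congrArg Subtype.val (smblHom_of (gr k Δ))
  · rw [transport_apply, AlgEquiv.symm_apply_apply, AlgEquiv.symm_apply_apply]
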